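/- **Theorem 1 (Linear time spectral density estimation).** Notation. Let $T_k$ be the Chebyshev polynomials of the first kind, $w(x) = 1/\sqrt{1-x^2}$, $\bar T_0 = T_0/\sqrt{\pi}$ and $\bar T_k = T_k/\sqrt{\pi/2}$ for $k \ge 1$. For $N \in 4\mathbb{N}^+$ and $0 \le k \le N$ let $$\hat b_N[k] = \sum_{j=-N/2-1}^{N/2+1-k} \left(\tfrac N2+1-|j|\right)\left(\tfrac N2+1-|j+k|\right).$$ For a Hermitian $A \in \mathbb{F}^{n\times n}$ ($\mathbb{F} = \mathbb{R}$ or $\mathbb{C}$, $n \ge 1$) with eigenvalues $\lambda_1,\dots,\lambda_n$, the spectral density is the probability measure $s = \frac1n\sum_{i=1}^n \delta_{\lambda_i}$. For a density $q$ on $[-1,1]$ let $W_1(s,q) = \sup_f \left(\int f\,ds - \int_{-1}^1 f(x)q(x)\,dx\right)$, the supremum being over all 1-Lipschitz $f:\mathbb{R}\to\mathbb{R}$. Algorithm (Jackson damped kernel polynomial method with Hutchinson moment estimation, with degree $N \in 4\mathbb{N}^+$ and $\ell \in \mathbb{N}^+$ repetitions). Draw $g^{(1)},\dots,g^{(\ell)}$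 independently and uniformly from $\{-1,1\}^n$. For $k = 1,\dots,N$ set $\tilde\tau_k = \frac{\sqrt{2/\pi}}{\ell n}\sum_{i=1}^{\ell} (g^{(i)})^\top T_k(A) g^{(i)}$, where the vectors $T_k(A)g^{(i)}$ are computed by the recurrence $T_0(A)g = g$, $T_1(A)g = Ag$, $T_k(A)g = 2A\,T_{k-1}(A)g - T_{k-2}(A)g$. Set $\tilde\tau_0 = 1/\sqrt\pi$ and return, in the form of its coefficients, the function $$q = \left( w\sum_{k=0}^N \frac{\hat b_N[k]}{\hat b_N[0]}\,\tilde\tau_k\,\bar T_k + \frac{w\sqrt2}{N\sqrt\pi}\right)\Big/\left(1 + \frac{\sqrt{2\pi}}{N}\right).$$ Theorem. There are absolute constants $C_0, C, C', C'' > 0$ such that the following holds for every Hermitian $A \in \mathbb{F}^{n\times n}$ with $\|A\|_2 \le 1$ and spectral density $s$, and all $\epsilon,\delta\in(0,1)$. Let $$L = \max\left(1,\ \frac{C'}{n}\,\epsilon^{-4}\log^2\!\left(\frac{1}{\epsilon\delta}\right)\right),$$ and run the algorithm with $\ell = \lceil L\rceil$ and $N = 4\lceil C_0/\epsilon\rceil$,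 in exact arithmetic. Then it always uses exactly $T = N\ell \le C L/\epsilon$ matrix-vector multiplications with $A$ and at most $C'' n L/\epsilon$ additional steps (arithmetic operations $+,-,\times,/,\sqrt{\cdot}$, loading of the constant $\pi$ and of integers, reading of random signs, and loop steps, at unit cost); its output $q$ is always a probability density function on $[-1,1]$; and $W_1(s,q)\le\epsilon$ with probability at least $1-\delta$. -/

import Mathlib

/-! ### Spectral density, densities on `[-1, 1]` and the Wasserstein-1 distance -/

/-- The spectral density `s = (1/n) ∑ᵢ δ_{λᵢ}` of a Hermitian matrix, as a measure on `ℝ`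
(the `λᵢ` are the eigenvalues, with multiplicity). -/
noncomputable def spectralDensity {𝕜 : Type} [RCLike 𝕜] {n : ℕ} {A : Matrix (Fin n) (Fin n) 𝕜}
    (hA : A.IsHermitian) : MeasureTheory.Measure ℝ :=
  (n : ENNReal)⁻¹ • ∑ i, MeasureTheory.Measure.dirac (hA.eigenvalues i)

/-- `q` is a probability density function on `[-1, 1]`. -/
def IsProbabilityDensity (q : ℝ → ℝ) : Prop :=
  (∀ x ∈ Set.Icc (-1 : ℝ) 1, 0 ≤ q x) ∧
    IntervalIntegrable q MeasureTheory.volume (-1) 1 ∧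
    ∫ x in (-1 : ℝ)..1, q x = 1

/-- The Wasserstein-1 distance (in its dual formulation) between a measure `s` on `ℝ`, supported
on `[-1, 1]`, and a density `q` on `[-1, 1]`: the supremum of `∫ f ds - ∫ f q dx` over all
1-Lipschitz `f : ℝ → ℝ`. -/
noncomputable def wasserstein1 (s : MeasureTheory.Measure ℝ) (q : ℝ → ℝ) : ENNReal :=
  ⨆ (f : ℝ → ℝ) (_ : LipschitzWith 1 f),
    ENNReal.ofReal ((∫ x, f x ∂s) - ∫ x in (-1 : ℝ)..1, f x * q x)

/-! ### Programs with a step count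

A program handles scalars of a type `K` on which it knows no operation: it can create scalars only
by the instructions below. `n` is the dimension of the matrix that can be applied to a vector, and
`ι` indexes the independent uniform random signs that the program may read. -/

/-- Programs that return a value of type `α`. -/
inductive Prog (K : Type) (n : ℕ) (ι : Type) : Type → Type 1
  /-- return a value -/
  | pure {α : Type} (a : α) : Prog K n ι α
  /-- run a program, then another one that depends on the returned value -/
  | bind {α β : Type} (p : Prog K n ι α) (f : α → Prog K n ι β) : Prog K n ι β
  /-- an integer constant, or an integer index, as a scalar -/
  | int (z : ℤ) : Prog K n ι K
  /-- the constant `π` -/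
  | pi : Prog K n ι K
  | add (x y : K) : Prog K n ι K
  | sub (x y : K) : Prog K n ι K
  | mul (x y : K) : Prog K n ι K
  | div (x y : K) : Prog K n ι K
  | sqrt (x : K) : Prog K n ι K
  /-- read the random sign with index `i` -/
  | sign (i : ι) : Prog K n ι K
  /-- one step of loop control -/
  | tick : Prog K n ι Unit
  /-- one multiplication of the input matrix with a vector -/
  | matvec (v : Fin n → K) : Prog K n ι (Fin n → K)

/-- The result of a run: the returned value, the number of matrix-vector multiplications, and the
number of all other steps. -/
structure Outcome (α : Type) where
  value : α
  matvecs : ℕ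
  steps : ℕ

namespace Prog

instance {K : Type} {n : ℕ} {ι : Type} : Monad (Prog K n ι) where
  pure := Prog.pure
  bind := Prog.bind

/-- Run a program over the scalars `ℝ` or `ℂ`, with exact arithmetic, on the matrix `A` and the
random signs `ω`. Every instruction other than `matvec` takes one step. -/
noncomputable def run {𝕜 : Type} [RCLike 𝕜] {n : ℕ} {ι : Type} (A : Matrix (Fin n) (Fin n) 𝕜)
    (ω : ι → ℤˣ) : {α : Type} → Prog 𝕜 n ι α → Outcome α
  | _, .pure a => ⟨a, 0, 0⟩
  | _, .bind p f =>
      ⟨((f (p.run A ω).value).run A ω).value,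
        (p.run A ω).matvecs + ((f (p.run A ω).value).run A ω).matvecs,
        (p.run A ω).steps + ((f (p.run A ω).value).run A ω).steps⟩
  | _, .int z => ⟨(z : 𝕜), 0, 1⟩
  | _, .pi => ⟨((Real.pi : ℝ) : 𝕜), 0, 1⟩
  | _, .add x y => ⟨x + y, 0, 1⟩
  | _, .sub x y => ⟨x - y, 0, 1⟩
  | _, .mul x y => ⟨x * y, 0, 1⟩
  | _, .div x y => ⟨x / y, 0, 1⟩
  | _, .sqrt x => ⟨((Real.sqrt (RCLike.re x) : ℝ) : 𝕜), 0, 1⟩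
  | _, .sign i => ⟨((ω i : ℤ) : 𝕜), 0, 1⟩
  | _, .tick => ⟨(), 0, 1⟩
  | _, .matvec v => ⟨A.mulVec v, 1, 0⟩

/-- Compute an array entry by entry. -/
def tabulate {K : Type} {n : ℕ} {ι α : Type} :
    (m : ℕ) → (Fin m → Prog K n ι α) → Prog K n ι (Fin m → α)
  | 0, _ => .pure Fin.elim0
  | m + 1, f => do
      let v ← tabulate m (fun i => f i.castSucc)
      tick
      let a ← f (Fin.last m)
      return Fin.snoc (α := fun _ => α) v a

/-- Compute `m` scalars and add them up. -/
def sum {K : Type} {n : ℕ} {ι : Type} : (m : ℕ) → (Fin m → Prog K n ι K) → Prog K n ι K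
  | 0, _ => int 0
  | m + 1, f => do
      let s ← sum m (fun i => f i.castSucc)
      tick
      let a ← f (Fin.last m)
      add s a

/-- The product `xᵀ y`. -/
def dot {K : Type} {n : ℕ} {ι : Type} (x y : Fin n → K) : Prog K n ι K :=
  sum n fun j => mul (x j) (y j)

/-- The vectors `T₀(A) g, …, T_N(A) g`, by the three-term recurrence `T₀(A) g = g`,
`T₁(A) g = A g`, `T_k(A) g = 2 A T_{k-1}(A) g - T_{k-2}(A) g`. -/
def chebyshevVectors {K : Type} {n : ℕ} {ι : Type} (g : Fin n → K) :
    (N : ℕ) → Prog K n ι (Fin (N + 1) → Fin n → K)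
  | 0 => .pure fun _ => g
  | 1 => do
      let v ← matvec g
      return ![g, v]
  | k + 2 => do
      let t ← chebyshevVectors g (k + 1)
      tick
      let v ← matvec (t (Fin.last (k + 1)))
      let two ← int 2
      let u ← tabulate n fun j => do
        let a ← mul two (v j)
        sub a (t (Fin.last k).castSucc j)
      return Fin.snoc (α := fun _ => Fin n → K) t u

/-- The Hutchinson moment estimator with degree `N` and `ℓ` repetitions: it draws
`g⁽¹⁾, …, g⁽ˡ⁾` uniformly from `{-1, 1}ⁿ` and returns
`τ_k = √(2/π) / (ℓ n) * ∑ᵢ (g⁽ⁱ⁾)ᵀ T_k(A) g⁽ⁱ⁾` for `k = 1, …, N` (at position `k - 1`). -/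
def hutchinson {K : Type} {n : ℕ} (N ℓ : ℕ) : Prog K n (Fin ℓ × Fin n) (Fin N → K) := do
  let g ← tabulate ℓ fun i => tabulate n fun j => sign (i, j)
  let quad ← tabulate ℓ fun i => do
    let t ← chebyshevVectors (g i) N
    tabulate N fun k => dot (g i) (t k.succ)
  let two ← int 2
  let p ← pi
  let x ← div two p
  let y ← sqrt x
  let l' ← int ℓ
  let n' ← int n
  let z ← mul l' n'
  let c ← div y z
  tabulate N fun k => do
    let s ← sum ℓ fun i => .pure (quad i k)
    mul c s

/-- The Jackson coefficient `b_N[k] = ∑_{j = -N/2-1}^{N/2+1-k} (N/2+1-|j|) (N/2+1-|j+k|)`, for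
`N` even and `k ≤ N`. The loop index `i` stands for `j = i - (N/2+1)`. -/
def jackson {K : Type} {n : ℕ} {ι : Type} (N k : ℕ) : Prog K n ι K :=
  sum (N + 3 - k) fun i => do
    let m : ℤ := N / 2 + 1
    let j : ℤ := i - m
    let a ← int (m - |j|)
    let b ← int (m - |j + k|)
    mul a b

end Prog

/-- The closed form of a density returned by the kernel polynomial method. It stands for
`(w * ∑ₖ coeff k * T̄ₖ + shift * w) / scale`. -/
structure KPMOutput (K : Type) (N : ℕ) where
  coeff : Fin (N + 1) → K
  shift : K
  scale : K

/-- The Jackson damped kernel polynomial method of degree `N`, with the program `M` as the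
subroutine that estimates the moments `τ₁, …, τ_N`. With `τ₀ = 1/√π` it returns the coefficients
`(b_N[k] / b_N[0]) * τ_k`, the shift `√2 / (N √π)` and the scale `1 + √(2π) / N`. -/
def Prog.kpm {K : Type} {n : ℕ} {ι : Type} (N : ℕ) (M : Prog K n ι (Fin N → K)) :
    Prog K n ι (KPMOutput K N) := do
  let τ ← M
  let one ← int 1
  let two ← int 2
  let p ← pi
  let n' ← int N
  let rp ← sqrt p
  let τ₀ ← div one rp
  let b ← tabulate (N + 1) fun k => jackson N k
  let c ← tabulate (N + 1) fun k => do
    let r ← div (b k) (b 0)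
    mul r (Fin.cons (α := fun _ => K) τ₀ τ k)
  let r₂ ← sqrt two
  let x ← mul n' rp
  let shift ← div r₂ x
  let y ← mul two p
  let ry ← sqrt y
  let z ← div ry n'
  let scale ← add one z
  return ⟨c, shift, scale⟩

/-- The weight `w(x) = 1 / √(1 - x²)` on `(-1, 1)`. -/
noncomputable def chebyshevWeight (x : ℝ) : ℝ := 1 / Real.sqrt (1 - x ^ 2)

/-- The normalized Chebyshev polynomial `T̄ₖ = Tₖ / √⟨Tₖ, w Tₖ⟩`, where `⟨T₀, w T₀⟩ = π` and
`⟨Tₖ, w Tₖ⟩ = π / 2` for `k > 0`. -/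
noncomputable def normalizedChebyshev (k : ℕ) (x : ℝ) : ℝ :=
  (Polynomial.Chebyshev.T ℝ k).eval x / Real.sqrt (if k = 0 then Real.pi else Real.pi / 2)

/-- The function that an output of the kernel polynomial method stands for. -/
noncomputable def KPMOutput.density {𝕜 : Type} [RCLike 𝕜] {N : ℕ} (o : KPMOutput 𝕜 N) (x : ℝ) : ℝ :=
  (chebyshevWeight x * ∑ k : Fin (N + 1), RCLike.re (o.coeff k) * normalizedChebyshev k x +
    RCLike.re o.shift * chebyshevWeight x) / RCLike.re o.scale

/-! In an eigenbasis u_j of A, a sign vector g satisfies gᵀ T_k(A) g = ∑_j |⟨u_j, g⟩|² T_k(λ_j), and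
the masses |⟨u_j, g⟩|² sum to ‖g‖² = n. The Hutchinson estimates are therefore, up to normalization,
exact Chebyshev moments of a random probability measure on the spectrum, with masses
`hutchinsonMass`. Jackson damping smears each point mass by a nonnegative kernel of integral 1, and
the shift mixes in the Chebyshev distribution with relative weight s = √(2π)/N (`density_run_kpm`).
So the output is a probability density for every choice of signs.

For the accuracy, smearing moves mass by O(1/N), mixing costs O(s), and replacing the masses 1/n by
the random ones costs at most 2Nη when all N moments are within η
(`sub_integral_dampedDensity_le_of_moments`). The moment errors are off-diagonal quadratic forms in
independent signs. Hypercontractivity (`chaosBound_quadratic`, `ChaosBound.tail`) bounds the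
probability of an error η by exp(-r) once η√(ℓn) is a large multiple of r. A union bound with η of
order ε² and r = log 84 + log(1/(εδ)) finishes this case.

When ε and δ are both close to 1, log(1/(εδ)) is close to 0 and ℓ may be too small for
concentration. There it is enough that W₁ is dominated by a nonnegative variable of mean at most 1 -
1/3840 (`mul_signProb_wasserstein1_gt_le`), by Markov's inequality. Coupling the two measures
independently costs at most 1 minus a multiple of the product of their means. Hutchinson's estimator
is unbiased, so a spectrum with nonzero mean gains in expectation; if the mean is near zero, the
admixture of the Chebyshev distribution gains instead. -/

/-! ### Jackson coefficients as autocorrelations of a triangle -/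

section Jackson

open Finset

/-- The triangular sequence `0, 1, …, M, …, 1, 0`. -/
noncomputable def triangle (M i : ℕ) : ℝ := M - |(i : ℝ) - M|

/-- The autocorrelation at lag `k` of the first `P` entries of a sequence. -/
noncomputable def autocorrelation (a : ℕ → ℝ) (P k : ℕ) : ℝ :=
  ∑ i ∈ range (P - k), a i * a (i + k)

/-- The double sum is grouped by the lag |i - l|. In the induction, the new pairs (i, P) extend the
autocorrelation at lag P - i by exactly one term. -/
theorem sum_sum_mul_cos_eq_autocorrelation (a : ℕ → ℝ) (P : ℕ) (t : ℝ) :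
    ∑ i ∈ range P, ∑ l ∈ range P, a i * a l * Real.cos (((i : ℝ) - l) * t) =
      autocorrelation a P 0 +
        2 * ∑ k ∈ range P, autocorrelation a P (k + 1) * Real.cos ((k + 1 : ℕ) * t) := by
  induction P with
  | zero => simp [autocorrelation]
  | succ P ih =>
    have h1 : ∑ i ∈ range (P + 1), ∑ l ∈ range (P + 1), a i * a l * Real.cos (((i : ℝ) - l) * t) =
        (∑ i ∈ range P, ∑ l ∈ range P, a i * a l * Real.cos (((i : ℝ) - l) * t)) +
          2 * (∑ i ∈ range P, a i * a P * Real.cos (((P : ℝ) - i) * t)) + a P * a P := by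
      rw [sum_range_succ]
      simp_rw [sum_range_succ (fun l => a _ * a l * Real.cos (((_ : ℝ) - l) * t))]
      rw [sum_add_distrib]
      have e1 : ∑ i ∈ range P, a i * a P * Real.cos (((i : ℝ) - P) * t) =
          ∑ i ∈ range P, a i * a P * Real.cos (((P : ℝ) - i) * t) :=
        sum_congr rfl fun i _ => by
          rw [← Real.cos_neg]; congr 2; ring
      have e2 : ∑ i ∈ range P, a P * a i * Real.cos (((P : ℝ) - i) * t) =
          ∑ i ∈ range P, a i * a P * Real.cos (((P : ℝ) - i) * t) :=
        sum_congr rfl fun i _ => by ring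
      rw [e1, e2]
      simp
      ring
    have h2 : autocorrelation a (P + 1) 0 = autocorrelation a P 0 + a P * a P := by
      simp [autocorrelation, sum_range_succ]
    have h3 : ∑ k ∈ range (P + 1), autocorrelation a (P + 1) (k + 1) * Real.cos ((k + 1 : ℕ) * t) =
        ∑ k ∈ range P, autocorrelation a P (k + 1) * Real.cos ((k + 1 : ℕ) * t) +
          ∑ i ∈ range P, a i * a P * Real.cos (((P : ℝ) - i) * t) := by
      rw [sum_range_succ]
      have e0 : autocorrelation a (P + 1) (P + 1) = 0 := by simp [autocorrelation]
      rw [e0, zero_mul, add_zero,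
        ← sum_range_reflect (fun i => a i * a P * Real.cos (((P : ℝ) - i) * t)) P,
        ← sum_add_distrib]
      refine sum_congr rfl fun k hk => ?_
      have hk : k < P := mem_range.1 hk
      have e1 : P + 1 - (k + 1) = (P - (k + 1)) + 1 := by omega
      have e2 : P - (k + 1) + (k + 1) = P := by omega
      have e3 : P - 1 - k = P - (k + 1) := by omega
      have e4 : ((P - (k + 1) : ℕ) : ℝ) = P - (k + 1) := by
        rw [Nat.cast_sub (by omega)]; push_cast; ring
      simp only [autocorrelation]
      rw [e1, sum_range_succ, e2, e3, e4]
      push_cast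
      rw [show (P : ℝ) - (P - (k + 1)) = k + 1 by ring]
      ring
    rw [h1, h2, h3, ih]
    ring

/-- The sum is |∑ a_i exp(√-1 i t)|², as in Fejér's theorem. -/
theorem autocorrelation_cos_sum_nonneg (a : ℕ → ℝ) (P : ℕ) (t : ℝ) :
    0 ≤ autocorrelation a P 0 +
        2 * ∑ k ∈ range P, autocorrelation a P (k + 1) * Real.cos ((k + 1 : ℕ) * t) := by
  rw [← sum_sum_mul_cos_eq_autocorrelation]
  have : ∑ i ∈ range P, ∑ l ∈ range P, a i * a l * Real.cos (((i : ℝ) - l) * t) =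
      (∑ i ∈ range P, a i * Real.cos (i * t)) ^ 2 + (∑ i ∈ range P, a i * Real.sin (i * t)) ^ 2 := by
    rw [sq, sq, sum_mul_sum, sum_mul_sum, ← sum_add_distrib]
    refine sum_congr rfl fun i _ => ?_
    rw [← sum_add_distrib]
    refine sum_congr rfl fun l _ => ?_
    rw [sub_mul, Real.cos_sub]
    ring
  rw [this]
  positivity

/-- Expanding the squares counts every a_i² twice except at the two ends, whence the boundary
corrections. -/
theorem sum_sub_sq_eq_autocorrelation (a : ℕ → ℝ) (P : ℕ) :
    ∑ i ∈ range P, (a i - a (i + 1)) ^ 2 =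
      2 * (autocorrelation a (P + 1) 0 - autocorrelation a (P + 1) 1) - a 0 ^ 2 - a P ^ 2 := by
  simp only [autocorrelation, Nat.add_sub_cancel, Nat.sub_zero, Nat.add_zero]
  induction P with
  | zero => simp; ring
  | succ P ih =>
    rw [sum_range_succ, ih, sum_range_succ _ (P + 1), sum_range_succ (fun i => a i * a (i + 1)) P]
    ring

theorem triangle_of_le {M i : ℕ} (h : i ≤ M) : triangle M i = i := by
  have : (i : ℝ) ≤ M := by exact_mod_cast h
  rw [triangle, abs_of_nonpos (by linarith)]
  ring

theorem triangle_of_ge {M i : ℕ} (h : M ≤ i) : triangle M i = 2 * M - i := by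
  have : (M : ℝ) ≤ i := by exact_mod_cast h
  rw [triangle, abs_of_nonneg (by linarith)]
  ring

theorem triangle_sub_sq (M i : ℕ) : (triangle M i - triangle M (i + 1)) ^ 2 = 1 := by
  rcases Nat.lt_or_ge i M with h | h
  · rw [triangle_of_le h.le, triangle_of_le h]; push_cast; ring
  · rw [triangle_of_ge h, triangle_of_ge (by omega)]; push_cast; ring

/-- The Jackson coefficient `b_N[k]` for `N = 2 h`. -/
noncomputable def jacksonCoeff (h k : ℕ) : ℝ := autocorrelation (triangle (h + 1)) (2 * h + 3) k

/-- The triangle vanishes at both end positions 0 and 2h + 2, and every product at a lag above 2h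
involves one of them. The cosine polynomial thus has degree only 2h = N. -/
theorem jacksonCoeff_cos_sum_nonneg (h : ℕ) (t : ℝ) :
    0 ≤ jacksonCoeff h 0 +
        2 * ∑ k ∈ range (2 * h), jacksonCoeff h (k + 1) * Real.cos ((k + 1 : ℕ) * t) := by
  have H := autocorrelation_cos_sum_nonneg (triangle (h + 1)) (2 * h + 3) t
  have z0 : triangle (h + 1) 0 = 0 := by rw [triangle_of_le (by omega)]; simp
  have z1 : triangle (h + 1) (2 * h + 1 + 1) = 0 := by
    rw [triangle_of_ge (by omega)]; push_cast; ring
  have e1 : autocorrelation (triangle (h + 1)) (2 * h + 3) (2 * h + 1) = 0 := by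
    have : 2 * h + 3 - (2 * h + 1) = 2 := by omega
    rw [autocorrelation, this, sum_range_succ, sum_range_one, z0]
    rw [show 1 + (2 * h + 1) = 2 * h + 1 + 1 by ring, z1]
    simp
  have e2 : autocorrelation (triangle (h + 1)) (2 * h + 3) (2 * h + 1 + 1) = 0 := by
    have : 2 * h + 3 - (2 * h + 1 + 1) = 1 := by omega
    rw [autocorrelation, this, sum_range_one, z0]
    simp
  have e3 : autocorrelation (triangle (h + 1)) (2 * h + 3) (2 * h + 2 + 1) = 0 := by
    simp [autocorrelation]
  rw [sum_range_succ, sum_range_succ, sum_range_succ, e1, e2, e3] at H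
  simpa [jacksonCoeff] using H

/-- Neighbouring entries differ by ±1 and the end entries are 0, so the identity for squared
differences reads 2h + 2 = 2 (b[0] - b[1]). -/
theorem jacksonCoeff_zero_sub_one (h : ℕ) : jacksonCoeff h 0 - jacksonCoeff h 1 = h + 1 := by
  have H := sum_sub_sq_eq_autocorrelation (triangle (h + 1)) (2 * h + 2)
  have z0 : triangle (h + 1) 0 = 0 := by rw [triangle_of_le (by omega)]; simp
  have z1 : triangle (h + 1) (2 * h + 2) = 0 := by
    rw [triangle_of_ge (by omega)]; push_cast; ring
  simp only [triangle_sub_sq, z0, z1] at H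
  simp at H
  unfold jacksonCoeff
  linarith

/-- Only the ascending half of the triangle is kept, where the squares 0², …, M² sum to at least
M³/3. -/
theorem le_jacksonCoeff_zero (h : ℕ) : (h + 1 : ℝ) ^ 3 / 3 ≤ jacksonCoeff h 0 := by
  have hs : ∀ m : ℕ, ((m : ℝ)) ^ 3 / 3 ≤ ∑ i ∈ range (m + 1), (i : ℝ) * i := by
    intro m
    induction m with
    | zero => simp
    | succ m ih =>
      rw [sum_range_succ]
      push_cast
      have : (0 : ℝ) ≤ m := by positivity
      nlinarith
  have h1 := hs (h + 1)
  push_cast at h1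
  refine h1.trans ?_
  calc ∑ i ∈ range (h + 1 + 1), (i : ℝ) * i
      = ∑ i ∈ range (h + 1 + 1), triangle (h + 1) i * triangle (h + 1) i :=
        sum_congr rfl fun i hi => by
          rw [triangle_of_le (by have := mem_range.1 hi; omega)]
    _ ≤ ∑ i ∈ range (2 * h + 3), triangle (h + 1) i * triangle (h + 1) i :=
        sum_le_sum_of_subset_of_nonneg (range_mono (by omega)) fun _ _ _ => mul_self_nonneg _

theorem jacksonCoeff_zero_pos (h : ℕ) : 0 < jacksonCoeff h 0 :=
  lt_of_lt_of_le (by positivity) (le_jacksonCoeff_zero h)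

theorem one_sub_jacksonCoeff_ratio_le (h : ℕ) :
    1 - jacksonCoeff h 1 / jacksonCoeff h 0 ≤ 3 / (h + 1 : ℝ) ^ 2 := by
  have h0 := jacksonCoeff_zero_pos h
  have hh : (0 : ℝ) < h + 1 := by positivity
  rw [one_sub_div h0.ne', jacksonCoeff_zero_sub_one, div_le_div_iff₀ h0 (by positivity)]
  nlinarith [le_jacksonCoeff_zero h]

end Jackson

/-! ### Values and costs of the programs -/

namespace Prog

variable {𝕜 : Type} [RCLike 𝕜] {n : ℕ} {ι : Type} (A : Matrix (Fin n) (Fin n) 𝕜) (ω : ι → ℤˣ)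

@[simp] theorem run_pure' {α : Type} (a : α) : (Prog.pure a : Prog 𝕜 n ι α).run A ω = ⟨a, 0, 0⟩ := rfl
@[simp] theorem run_pure {α : Type} (a : α) : (Pure.pure a : Prog 𝕜 n ι α).run A ω = ⟨a, 0, 0⟩ := rfl

@[simp] theorem run_bind {α β : Type} (p : Prog 𝕜 n ι α) (f : α → Prog 𝕜 n ι β) :
    (p >>= f).run A ω =
      ⟨((f (p.run A ω).value).run A ω).value,
        (p.run A ω).matvecs + ((f (p.run A ω).value).run A ω).matvecs,
        (p.run A ω).steps + ((f (p.run A ω).value).run A ω).steps⟩ := rfl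

@[simp] theorem run_int (z : ℤ) : (Prog.int z : Prog 𝕜 n ι 𝕜).run A ω = ⟨(z : 𝕜), 0, 1⟩ := rfl
@[simp] theorem run_pi : (Prog.pi : Prog 𝕜 n ι 𝕜).run A ω = ⟨((Real.pi : ℝ) : 𝕜), 0, 1⟩ := rfl
@[simp] theorem run_add (x y : 𝕜) : (Prog.add x y : Prog 𝕜 n ι 𝕜).run A ω = ⟨x + y, 0, 1⟩ := rfl
@[simp] theorem run_sub (x y : 𝕜) : (Prog.sub x y : Prog 𝕜 n ι 𝕜).run A ω = ⟨x - y, 0, 1⟩ := rfl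
@[simp] theorem run_mul (x y : 𝕜) : (Prog.mul x y : Prog 𝕜 n ι 𝕜).run A ω = ⟨x * y, 0, 1⟩ := rfl
@[simp] theorem run_div (x y : 𝕜) : (Prog.div x y : Prog 𝕜 n ι 𝕜).run A ω = ⟨x / y, 0, 1⟩ := rfl
@[simp] theorem run_sqrt (x : 𝕜) : (Prog.sqrt x : Prog 𝕜 n ι 𝕜).run A ω =
    ⟨((Real.sqrt (RCLike.re x) : ℝ) : 𝕜), 0, 1⟩ := rfl
@[simp] theorem run_sign (i : ι) : (Prog.sign i : Prog 𝕜 n ι 𝕜).run A ω = ⟨((ω i : ℤ) : 𝕜), 0, 1⟩ := rfl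
@[simp] theorem run_tick : (Prog.tick : Prog 𝕜 n ι Unit).run A ω = ⟨(), 0, 1⟩ := rfl
@[simp] theorem run_matvec (v : Fin n → 𝕜) :
    (Prog.matvec v : Prog 𝕜 n ι (Fin n → 𝕜)).run A ω = ⟨A.mulVec v, 1, 0⟩ := rfl

theorem run_tabulate {α : Type} (m : ℕ) (f : Fin m → Prog 𝕜 n ι α) :
    (tabulate m f).run A ω =
      ⟨fun i => ((f i).run A ω).value, ∑ i, ((f i).run A ω).matvecs,
        ∑ i, (1 + ((f i).run A ω).steps)⟩ := by
  induction m with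
  | zero =>
    simp only [tabulate, run_pure', Finset.univ_eq_empty, Finset.sum_empty, Outcome.mk.injEq,
      and_true]
    exact Subsingleton.elim _ _
  | succ m ih =>
    simp only [tabulate, run_bind, run_pure, run_tick, ih, Fin.sum_univ_castSucc, Outcome.mk.injEq]
    refine ⟨?_, by ring, by ring⟩
    funext i
    refine Fin.lastCases ?_ (fun i => ?_) i <;> simp

theorem run_sum (m : ℕ) (f : Fin m → Prog 𝕜 n ι 𝕜) :
    (sum m f).run A ω =
      ⟨∑ i, ((f i).run A ω).value, ∑ i, ((f i).run A ω).matvecs,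
        1 + ∑ i, (2 + ((f i).run A ω).steps)⟩ := by
  induction m with
  | zero => simp [sum]
  | succ m ih =>
    simp only [sum, run_bind, run_tick, run_add, ih, Fin.sum_univ_castSucc, Outcome.mk.injEq,
      true_and]
    exact ⟨by ring, by ring⟩

theorem run_dot (x y : Fin n → 𝕜) :
    (dot x y : Prog 𝕜 n ι 𝕜).run A ω = ⟨x ⬝ᵥ y, 0, 1 + n * 3⟩ := by
  simp [dot, run_sum, dotProduct]

theorem run_chebyshevVectors_matvecs (g : Fin n → 𝕜) (N : ℕ) :
    ((chebyshevVectors g N : Prog 𝕜 n ι _).run A ω).matvecs = N := by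
  induction N with
  | zero => simp [chebyshevVectors]
  | succ N ih =>
    cases N with
    | zero => simp [chebyshevVectors]
    | succ N => simp [chebyshevVectors, run_tabulate, ih]

theorem run_chebyshevVectors_steps_le (g : Fin n → 𝕜) (N : ℕ) :
    ((chebyshevVectors g N : Prog 𝕜 n ι _).run A ω).steps ≤ N * (2 + n * 3) := by
  induction N with
  | zero => simp [chebyshevVectors]
  | succ N ih =>
    cases N with
    | zero => simp [chebyshevVectors]
    | succ N =>
      simp only [chebyshevVectors, run_bind, run_tabulate, run_tick, run_matvec, run_int, run_pure,
        run_mul, run_sub, Finset.sum_const, Finset.card_univ, Fintype.card_fin, smul_eq_mul]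
      calc _ ≤ (N + 1) * (2 + n * 3) + (1 + (0 + (1 + (n * 3)))) := by
            refine Nat.add_le_add ih ?_
            simp
        _ = (N + 1 + 1) * (2 + n * 3) := by ring

theorem run_chebyshevVectors_value (g : Fin n → 𝕜) (N : ℕ) (k : Fin (N + 1)) :
    ((chebyshevVectors g N : Prog 𝕜 n ι _).run A ω).value k =
      (Polynomial.aeval A (Polynomial.Chebyshev.T 𝕜 (k : ℕ))).mulVec g := by
  induction N with
  | zero =>
    fin_cases k
    simp [chebyshevVectors]
  | succ N ih =>
    cases N with
    | zero =>
      fin_cases k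
      · simp [chebyshevVectors]
      · simp [chebyshevVectors]
    | succ N =>
      simp only [chebyshevVectors, run_bind, run_tabulate, run_tick, run_matvec, run_int, run_pure,
        run_mul, run_sub]
      refine Fin.lastCases ?_ (fun k => ?_) k
      · funext j
        have e : ((Fin.last (N + 1 + 1) : Fin (N + 1 + 1 + 1)) : ℕ) = N + 2 := rfl
        rw [Fin.snoc_last, ih, ih, e]
        push_cast
        rw [Polynomial.Chebyshev.T_add_two]
        simp [Matrix.sub_mulVec, ← Matrix.mulVec_mulVec, mul_assoc]
        rw [map_ofNat, Matrix.ofNat_mulVec]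
        simp
      · rw [Fin.snoc_castSucc, ih]
        rfl

/-- With j = i - (h + 1), the two factors are the triangle at positions i and i + k. The integer
division N / 2 is exact because N = 2h. -/
theorem run_jackson_value (h k : ℕ) :
    ((jackson (2 * h) k : Prog 𝕜 n ι 𝕜).run A ω).value = ((jacksonCoeff h k : ℝ) : 𝕜) := by
  have key : ∀ (z : ℤ) (r : ℝ), (z : ℝ) = r → (z : 𝕜) = ((r : ℝ) : 𝕜) := by
    rintro z _ rfl
    simp
  simp only [jackson, run_sum, run_bind, run_int, run_mul]
  rw [jacksonCoeff, autocorrelation, Finset.sum_range, RCLike.ofReal_sum]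
  refine Finset.sum_congr rfl fun i _ => ?_
  have e1 : (((2 * h : ℕ) : ℤ) / 2) = h := by omega
  rw [RCLike.ofReal_mul, e1]
  congr 1
  · refine key _ _ ?_
    simp [triangle]
  · refine key _ _ ?_
    simp only [triangle]
    push_cast
    congr 2
    ring

theorem run_jackson_matvecs (N k : ℕ) :
    ((jackson N k : Prog 𝕜 n ι 𝕜).run A ω).matvecs = 0 := by
  simp [jackson, run_sum]

theorem run_jackson_steps_le (N k : ℕ) :
    ((jackson N k : Prog 𝕜 n ι 𝕜).run A ω).steps ≤ 1 + (N + 3) * 5 := by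
  simp [jackson, run_sum]

/-- The sign vector of the `i`-th repetition. -/
def signVector (𝕜 : Type) [RCLike 𝕜] {n ℓ : ℕ} (ω : Fin ℓ × Fin n → ℤˣ) (i : Fin ℓ) (j : Fin n) : 𝕜 :=
  ((ω (i, j) : ℤ) : 𝕜)

theorem run_hutchinson_value {N ℓ : ℕ} (ω : Fin ℓ × Fin n → ℤˣ) (k : Fin N) :
    ((hutchinson N ℓ : Prog 𝕜 n _ _).run A ω).value k =
      ((Real.sqrt (2 / Real.pi) : ℝ) : 𝕜) / ((ℓ : 𝕜) * (n : 𝕜)) *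
        ∑ i, signVector 𝕜 ω i ⬝ᵥ
          (Polynomial.aeval A (Polynomial.Chebyshev.T 𝕜 ((k : ℕ) + 1 : ℕ))).mulVec
            (signVector 𝕜 ω i) := by
  have e : (2 : 𝕜) / ((Real.pi : ℝ) : 𝕜) = ((2 / Real.pi : ℝ) : 𝕜) := by push_cast; rfl
  simp only [hutchinson, run_bind, run_tabulate, run_pure', run_dot, run_sum, run_int, run_pi, run_sqrt,
    run_mul, run_div, run_sign, run_chebyshevVectors_value, Int.cast_ofNat, Int.cast_natCast, e,
    RCLike.ofReal_re]
  rfl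

theorem run_hutchinson_matvecs {N ℓ : ℕ} (ω : Fin ℓ × Fin n → ℤˣ) :
    ((hutchinson N ℓ : Prog 𝕜 n _ _).run A ω).matvecs = N * ℓ := by
  simp [hutchinson, run_tabulate, run_dot, run_sum, run_chebyshevVectors_matvecs, mul_comm]

theorem run_hutchinson_steps_le {N ℓ : ℕ} (hn : 1 ≤ n) (hN : 1 ≤ N) (hℓ : 1 ≤ ℓ)
    (ω : Fin ℓ × Fin n → ℤˣ) :
    ((hutchinson N ℓ : Prog 𝕜 n _ _).run A ω).steps ≤ 30 * (n * N * ℓ) := by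
  have h1 : ((hutchinson N ℓ : Prog 𝕜 n _ _).run A ω).steps ≤
      ℓ * (1 + n * 2) + (ℓ * (1 + (N * (2 + n * 3) + N * (1 + (1 + n * 3)))) +
        (8 + N * (3 + ℓ * 2))) := by
    simp only [hutchinson, run_bind, run_tabulate, run_pure', run_dot, run_sum, run_int, run_pi,
      run_sqrt, run_mul, run_div, run_sign, Finset.sum_const, Finset.card_univ, Fintype.card_fin,
      smul_eq_mul]
    refine Nat.add_le_add (by simp) (Nat.add_le_add ?_ ?_)
    · refine (Finset.sum_le_card_nsmul _ _
        (1 + (N * (2 + n * 3) + N * (1 + (1 + n * 3)))) fun i _ => ?_).trans_eq (by simp)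
      exact Nat.add_le_add_left (Nat.add_le_add_right (run_chebyshevVectors_steps_le A ω _ _) _) _
    · nlinarith
  refine h1.trans ?_
  -- Since n, N and ℓ are at least 1, every lower-order term is absorbed into n N ℓ.
  have a1 : N * ℓ ≤ n * N * ℓ := by nlinarith [Nat.zero_le (N * ℓ)]
  have a2 : n * ℓ ≤ n * N * ℓ := by nlinarith [Nat.zero_le (n * ℓ)]
  have a3 : ℓ ≤ N * ℓ := by nlinarith
  have a4 : N ≤ N * ℓ := by nlinarith
  have a5 : 1 ≤ ℓ := hℓ
  nlinarith

theorem run_kpm_value {h : ℕ} (M : Prog 𝕜 n ι (Fin (2 * h) → 𝕜)) :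
    ((kpm (2 * h) M).run A ω).value =
      { coeff := fun k => ((jacksonCoeff h k / jacksonCoeff h 0 : ℝ) : 𝕜) *
          Fin.cons (α := fun _ => 𝕜) ((1 / Real.sqrt Real.pi : ℝ) : 𝕜) (M.run A ω).value k
        shift := ((Real.sqrt 2 / ((2 * h : ℕ) * Real.sqrt Real.pi) : ℝ) : 𝕜)
        scale := ((1 + Real.sqrt (2 * Real.pi) / (2 * h : ℕ) : ℝ) : 𝕜) } := by
  have e : (2 : 𝕜) * ((Real.pi : ℝ) : 𝕜) = ((2 * Real.pi : ℝ) : 𝕜) := by push_cast; rfl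
  have e2 : RCLike.re (2 : 𝕜) = 2 := by
    simp
  simp only [kpm, run_bind, run_tabulate, run_pure, run_int, run_pi,
      run_sqrt, run_mul, run_div, run_add, Int.cast_ofNat, Int.cast_natCast, e, RCLike.ofReal_re,
      Int.cast_one, e2]
  congr 1
  · funext k
    rw [run_jackson_value, run_jackson_value]
    push_cast
    rfl
  · push_cast; rfl
  · push_cast; rfl

theorem run_kpm_matvecs {N : ℕ} (M : Prog 𝕜 n ι (Fin N → 𝕜)) :
    ((kpm N M).run A ω).matvecs = (M.run A ω).matvecs := by
  simp [kpm, run_tabulate, run_jackson_matvecs]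

/-- The quadratic term pays for N + 1 Jackson coefficients, each a sum of O(N) products. -/
theorem run_kpm_steps_le {N : ℕ} (hN : 1 ≤ N) (M : Prog 𝕜 n ι (Fin N → 𝕜)) :
    ((kpm N M).run A ω).steps ≤ (M.run A ω).steps + 100 * N ^ 2 := by
  have h1 : ((kpm N M).run A ω).steps ≤
      (M.run A ω).steps + ((N + 1) * (1 + (1 + (N + 3) * 5)) + (N + 1) * 3 + 13) := by
    have h2 : ∑ k : Fin (N + 1), (1 + ((jackson N k : Prog 𝕜 n ι 𝕜).run A ω).steps) ≤
        (N + 1) * (1 + (1 + (N + 3) * 5)) := by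
      refine (Finset.sum_le_card_nsmul _ _ (1 + (1 + (N + 3) * 5)) fun i _ => ?_).trans_eq
        (by simp)
      exact Nat.add_le_add_left (run_jackson_steps_le A ω _ _) _
    simp only [kpm, run_bind, run_tabulate, run_pure, run_int, run_pi,
      run_sqrt, run_mul, run_div, run_add, Finset.sum_const, Finset.card_univ, Fintype.card_fin,
      smul_eq_mul]
    omega
  refine h1.trans (Nat.add_le_add_left ?_ _)
  nlinarith

end Prog

/-! ### Chebyshev polynomials of a Hermitian matrix -/

namespace Matrix.IsHermitian

open Matrix Finset

variable {𝕜 : Type} [RCLike 𝕜] {n : ℕ} {A : Matrix (Fin n) (Fin n) 𝕜} (hA : A.IsHermitian)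

theorem aeval_eq (p : Polynomial 𝕜) :
    Polynomial.aeval A p = (hA.eigenvectorUnitary : Matrix (Fin n) (Fin n) 𝕜) *
      diagonal (fun j => p.eval ((hA.eigenvalues j : ℝ) : 𝕜)) *
        star (hA.eigenvectorUnitary : Matrix (Fin n) (Fin n) 𝕜) := by
  conv_lhs => rw [hA.spectral_theorem]
  have h1 : ∀ x, Polynomial.aeval (Unitary.conjStarAlgAut 𝕜 _ hA.eigenvectorUnitary x) p =
      Unitary.conjStarAlgAut 𝕜 _ hA.eigenvectorUnitary (Polynomial.aeval x p) := fun x =>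
    Polynomial.aeval_algHom_apply (Unitary.conjStarAlgAut 𝕜 _ hA.eigenvectorUnitary) x p
  have h2 : ∀ d : Fin n → 𝕜, Polynomial.aeval (diagonal d) p = diagonal (fun j => p.eval (d j)) := by
    intro d
    have := Polynomial.aeval_algHom_apply (diagonalAlgHom (n := Fin n) (α := 𝕜) 𝕜) d p
    simp only [diagonalAlgHom_apply] at this
    rw [this]
    congr 1
    funext j
    have h3 := Polynomial.aeval_algHom_apply (Pi.evalAlgHom 𝕜 (fun _ : Fin n => 𝕜) j) d p
    simp only [Pi.evalAlgHom_apply] at h3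
    rw [← h3, Polynomial.coe_aeval_eq_eval]
  rw [h1, h2, Unitary.conjStarAlgAut_apply]
  rfl

theorem aeval_chebyshev (k : ℕ) :
    Polynomial.aeval A (Polynomial.Chebyshev.T 𝕜 k) =
      (hA.eigenvectorUnitary : Matrix (Fin n) (Fin n) 𝕜) *
        diagonal (fun j => (((Polynomial.Chebyshev.T ℝ k).eval (hA.eigenvalues j) : ℝ) : 𝕜)) *
        star (hA.eigenvectorUnitary : Matrix (Fin n) (Fin n) 𝕜) := by
  rw [hA.aeval_eq]
  congr 3
  funext j
  exact (Polynomial.Chebyshev.algebraMap_eval_T (R := ℝ) (R' := 𝕜) (hA.eigenvalues j) k).symm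

theorem abs_eigenvalues_le_one (h : ‖Matrix.toEuclideanCLM (𝕜 := 𝕜) A‖ ≤ 1) (j : Fin n) :
    |hA.eigenvalues j| ≤ 1 := by
  have h1 := (Matrix.toEuclideanCLM (𝕜 := 𝕜) A).le_of_opNorm_le h (hA.eigenvectorBasis j)
  have h2 : Matrix.toEuclideanCLM (𝕜 := 𝕜) A (hA.eigenvectorBasis j) =
      ((hA.eigenvalues j : ℝ) : 𝕜) • hA.eigenvectorBasis j := by
    apply (WithLp.ofLp_injective 2)
    rw [Matrix.ofLp_toEuclideanCLM, hA.mulVec_eigenvectorBasis]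
    ext i
    simp [RCLike.real_smul_eq_coe_mul]
  rw [h2, norm_smul, hA.eigenvectorBasis.orthonormal.1 j] at h1
  simpa using h1

/-- The squared modulus of the component of `g` along the `j`-th eigenvector. -/
noncomputable def componentSq (g : Fin n → 𝕜) (j : Fin n) : ℝ :=
  ‖(star (hA.eigenvectorUnitary : Matrix (Fin n) (Fin n) 𝕜) *ᵥ g) j‖ ^ 2

theorem componentSq_nonneg (g : Fin n → 𝕜) (j : Fin n) : 0 ≤ hA.componentSq g j := sq_nonneg _

/-- After diagonalization the quadratic form is a moment of a positive measure on the spectrum. This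
is the source of the positivity of the output. -/
theorem star_dotProduct_aeval_chebyshev_mulVec (g : Fin n → 𝕜) (k : ℕ) :
    star g ⬝ᵥ (Polynomial.aeval A (Polynomial.Chebyshev.T 𝕜 k)) *ᵥ g =
      ((∑ j, hA.componentSq g j * (Polynomial.Chebyshev.T ℝ k).eval (hA.eigenvalues j) : ℝ) : 𝕜) := by
  rw [hA.aeval_chebyshev, ← mulVec_mulVec, ← mulVec_mulVec, dotProduct_mulVec]
  have : star g ᵥ* (hA.eigenvectorUnitary : Matrix (Fin n) (Fin n) 𝕜) =
      star (star (hA.eigenvectorUnitary : Matrix (Fin n) (Fin n) 𝕜) *ᵥ g) := by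
    rw [star_mulVec, star_eq_conjTranspose, conjTranspose_conjTranspose]
  rw [this, dotProduct, RCLike.ofReal_sum]
  refine sum_congr rfl fun j _ => ?_
  rw [mulVec_diagonal, componentSq, Pi.star_apply, RCLike.ofReal_mul, RCLike.ofReal_pow,
    ← RCLike.conj_mul]
  simp only [starRingEnd_apply]
  ring

theorem trace_aeval_chebyshev (k : ℕ) :
    (Polynomial.aeval A (Polynomial.Chebyshev.T 𝕜 k)).trace =
      ((∑ j, (Polynomial.Chebyshev.T ℝ k).eval (hA.eigenvalues j) : ℝ) : 𝕜) := by
  rw [hA.aeval_chebyshev, trace_mul_comm, ← mul_assoc, Unitary.coe_star_mul_self, one_mul,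
    trace_diagonal]
  push_cast
  rfl

/-- The squared Frobenius norm tr(B Bᴴ) is unitarily invariant. It controls the variance of the
Hutchinson estimator. -/
theorem sum_norm_sq_aeval_chebyshev (k : ℕ) :
    ∑ a, ∑ b, ‖(Polynomial.aeval A (Polynomial.Chebyshev.T 𝕜 k)) a b‖ ^ 2 =
      ∑ j, (Polynomial.Chebyshev.T ℝ k).eval (hA.eigenvalues j) ^ 2 := by
  apply RCLike.ofReal_injective (K := 𝕜)
  set B := Polynomial.aeval A (Polynomial.Chebyshev.T 𝕜 k) with hB
  have h1 : ((∑ a, ∑ b, ‖B a b‖ ^ 2 : ℝ) : 𝕜) = (B * Bᴴ).trace := by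
    simp only [trace, diag_apply, mul_apply, conjTranspose_apply]
    push_cast
    refine sum_congr rfl fun a _ => sum_congr rfl fun b _ => ?_
    rw [← RCLike.mul_conj, starRingEnd_apply]
  rw [h1, hB, hA.aeval_chebyshev]
  set U := (hA.eigenvectorUnitary : Matrix (Fin n) (Fin n) 𝕜) with hU
  have hUU : star U * U = 1 := Unitary.coe_star_mul_self _
  rw [conjTranspose_mul, conjTranspose_mul, ← star_eq_conjTranspose, ← star_eq_conjTranspose U,
    star_star, diagonal_conjTranspose]
  have : ∀ D E : Matrix (Fin n) (Fin n) 𝕜, (U * D * star U * (U * (E * star U))).trace =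
      (D * E).trace := by
    intro D E
    calc (U * D * star U * (U * (E * star U))).trace
        = (U * D * (star U * U) * (E * star U)).trace := by simp only [mul_assoc]
      _ = (U * (D * E * star U)).trace := by rw [hUU]; simp only [mul_one, mul_assoc]
      _ = _ := by rw [trace_mul_comm, mul_assoc, hUU, mul_one]
  rw [this, diagonal_mul_diagonal, trace_diagonal]
  rw [RCLike.ofReal_sum]
  refine sum_congr rfl fun j _ => ?_
  rw [Pi.star_apply, RCLike.star_def, RCLike.conj_ofReal, RCLike.ofReal_pow, sq]

end Matrix.IsHermitian

/-! ### Moments and tails of polynomials in random signs -/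

section Rademacher

open Finset

/-- From j to j + 1, the ratio of the left side to C(q, j) grows by the factor (2q - 2j - 1)/(2j +
1), which is at most 2q - 1. -/
theorem choose_two_mul_le (q j : ℕ) (hq : 1 ≤ q) :
    ((2 * q).choose (2 * j) : ℝ) ≤ (2 * q - 1 : ℝ) ^ j * q.choose j := by
  induction j with
  | zero => simp
  | succ j ih =>
    rcases Nat.lt_or_ge j q with hj | hj
    · have h1 := Nat.choose_succ_right_eq (2 * q) (2 * j)
      have h2 := Nat.choose_succ_right_eq (2 * q) (2 * j + 1)
      have h3 := Nat.choose_succ_right_eq q j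
      have hjr : (j : ℝ) + 1 ≤ q := by exact_mod_cast hj
      have h1' : ((2 * q).choose (2 * j + 1) : ℝ) * (2 * j + 1) =
          (2 * q).choose (2 * j) * (2 * q - 2 * j) := by
        have := congrArg (Nat.cast (R := ℝ)) h1
        rw [Nat.cast_mul, Nat.cast_mul, Nat.cast_sub (by omega)] at this
        push_cast at this
        exact this
      have h2' : ((2 * q).choose (2 * j + 2) : ℝ) * (2 * j + 2) =
          (2 * q).choose (2 * j + 1) * (2 * q - (2 * j + 1)) := by
        have := congrArg (Nat.cast (R := ℝ)) h2
        rw [Nat.cast_mul, Nat.cast_mul, Nat.cast_sub (by omega)] at this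
        push_cast at this
        linarith
      have h3' : (q.choose (j + 1) : ℝ) * (j + 1) = q.choose j * (q - j) := by
        have := congrArg (Nat.cast (R := ℝ)) h3
        rw [Nat.cast_mul, Nat.cast_mul, Nat.cast_sub (by omega)] at this
        push_cast at this
        exact this
      rw [show 2 * (j + 1) = 2 * j + 2 by ring]
      have hj0 : (0 : ℝ) ≤ j := by positivity
      have hpos : (0 : ℝ) < (2 * j + 2) * (2 * j + 1) := by positivity
      refine le_of_mul_le_mul_right ?_ hpos
      have hp : (0 : ℝ) ≤ (2 * q - 1 : ℝ) ^ j := pow_nonneg (by linarith) _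
      calc ((2 * q).choose (2 * j + 2) : ℝ) * ((2 * j + 2) * (2 * j + 1))
          = (2 * q).choose (2 * j) * ((2 * q - 2 * j) * (2 * q - (2 * j + 1))) := by
            linear_combination (2 * (j : ℝ) + 1) * h2' + (2 * (q : ℝ) - (2 * j + 1)) * h1'
        _ ≤ ((2 * q - 1 : ℝ) ^ j * q.choose j) * ((2 * q - 2 * j) * (2 * q - (2 * j + 1))) :=
            mul_le_mul_of_nonneg_right ih (mul_nonneg (by linarith) (by linarith))
        _ ≤ ((2 * q - 1 : ℝ) ^ j * q.choose j) *
              ((2 * q - 2 * j) * ((2 * q - 1) * (2 * j + 1))) := by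
            refine mul_le_mul_of_nonneg_left ?_ (by positivity)
            refine mul_le_mul_of_nonneg_left ?_ (by linarith)
            nlinarith
        _ = _ := by
            rw [pow_succ]
            linear_combination (-2 * (2 * (q : ℝ) - 1) ^ j * (2 * q - 1) * (2 * j + 1)) * h3'
    · have : (2 * q).choose (2 * (j + 1)) = 0 := Nat.choose_eq_zero_of_lt (by omega)
      rw [this]
      have hq' : (1 : ℝ) ≤ q := by exact_mod_cast hq
      have hp : (0 : ℝ) ≤ (2 * q - 1 : ℝ) ^ (j + 1) := pow_nonneg (by linarith) _
      simp only [Nat.cast_zero]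
      positivity

theorem sum_range_two_mul_add_one (f : ℕ → ℝ) (q : ℕ) :
    ∑ m ∈ range (2 * q + 1), f m =
      ∑ j ∈ range (q + 1), f (2 * j) + ∑ j ∈ range q, f (2 * j + 1) := by
  induction q with
  | zero => simp
  | succ q ih =>
    rw [show 2 * (q + 1) + 1 = 2 * q + 1 + 1 + 1 by ring, sum_range_succ, sum_range_succ, ih,
      sum_range_succ _ (q + 1), sum_range_succ (fun j => f (2 * j + 1)) q]
    rw [show 2 * (q + 1) = 2 * q + 1 + 1 by ring]
    ring

/-- The odd powers of b cancel in the average, and the even ones are compared term by term by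
`choose_two_mul_le`. -/
theorem two_point_hypercontractive (a b : ℝ) (q : ℕ) (hq : 1 ≤ q) :
    ((a + b) ^ (2 * q) + (a - b) ^ (2 * q)) / 2 ≤ (a ^ 2 + (2 * q - 1) * b ^ 2) ^ q := by
  have h1 : ((a + b) ^ (2 * q) + (a - b) ^ (2 * q)) / 2 =
      ∑ j ∈ range (q + 1), (b ^ 2) ^ j * (a ^ 2) ^ (q - j) * (2 * q).choose (2 * j) := by
    rw [add_comm a b, sub_eq_neg_add, add_pow, add_pow, sum_range_two_mul_add_one,
      sum_range_two_mul_add_one]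
    have e1 : ∀ j ∈ range (q + 1), b ^ (2 * j) * a ^ (2 * q - 2 * j) * ((2 * q).choose (2 * j) : ℝ) =
        (b ^ 2) ^ j * (a ^ 2) ^ (q - j) * (2 * q).choose (2 * j) := by
      intro j _
      rw [← Nat.mul_sub, pow_mul, pow_mul]
    have e2 : ∀ j ∈ range (q + 1),
        (-b) ^ (2 * j) * a ^ (2 * q - 2 * j) * ((2 * q).choose (2 * j) : ℝ) =
        (b ^ 2) ^ j * (a ^ 2) ^ (q - j) * (2 * q).choose (2 * j) := by
      intro j _
      rw [← Nat.mul_sub, pow_mul, pow_mul, neg_sq]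
    have e3 : ∀ j ∈ range q,
        (-b) ^ (2 * j + 1) * a ^ (2 * q - (2 * j + 1)) * ((2 * q).choose (2 * j + 1) : ℝ) =
        -(b ^ (2 * j + 1) * a ^ (2 * q - (2 * j + 1)) * (2 * q).choose (2 * j + 1)) := by
      intro j _
      rw [Odd.neg_pow ⟨j, rfl⟩]
      ring
    rw [sum_congr rfl e1, sum_congr rfl e2, sum_congr rfl e3, sum_neg_distrib]
    ring
  rw [h1, add_comm (a ^ 2), add_pow]
  refine sum_le_sum fun j _ => ?_
  calc (b ^ 2) ^ j * (a ^ 2) ^ (q - j) * ((2 * q).choose (2 * j) : ℝ)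
      ≤ (b ^ 2) ^ j * (a ^ 2) ^ (q - j) * ((2 * q - 1 : ℝ) ^ j * q.choose j) :=
        mul_le_mul_of_nonneg_left (choose_two_mul_le q j hq) (by positivity)
    _ = _ := by rw [mul_pow]; ring

variable {ι : Type}

/-- The `i`-th sign as a real number. -/
def rsign (i : ι) (ω : ι → ℤˣ) : ℝ := ((ω i : ℤ) : ℝ)

theorem rsign_sq (i : ι) (ω : ι → ℤˣ) : rsign i ω ^ 2 = 1 := by
  rcases Int.units_eq_one_or (ω i) with h | h <;> simp [rsign, h]

variable [DecidableEq ι]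

/-- Flip the `k`-th sign. -/
def flipSign (k : ι) (ω : ι → ℤˣ) : ι → ℤˣ := ω * Pi.mulSingle k (-1)

theorem flipSign_self (k : ι) (ω : ι → ℤˣ) : flipSign k ω k = -ω k := by
  simp [flipSign]

theorem flipSign_of_ne {k i : ι} (h : i ≠ k) (ω : ι → ℤˣ) : flipSign k ω i = ω i := by
  simp [flipSign, h]

theorem rsign_flipSign_of_ne {k i : ι} (h : i ≠ k) (ω : ι → ℤˣ) :
    rsign i (flipSign k ω) = rsign i ω := by
  rw [rsign, flipSign_of_ne h, rsign]

variable [Fintype ι]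

/-- The expectation of a function of independent uniform signs. -/
noncomputable def signMean (F : (ι → ℤˣ) → ℝ) : ℝ := (∑ ω, F ω) / Fintype.card (ι → ℤˣ)

theorem card_signs_pos : (0 : ℝ) < Fintype.card (ι → ℤˣ) := by
  exact_mod_cast Fintype.card_pos

theorem signMean_mono {F G : (ι → ℤˣ) → ℝ} (h : ∀ ω, F ω ≤ G ω) : signMean F ≤ signMean G :=
  div_le_div_of_nonneg_right (sum_le_sum fun ω _ => h ω) card_signs_pos.le

theorem signMean_add (F G : (ι → ℤˣ) → ℝ) :
    signMean (fun ω => F ω + G ω) = signMean F + signMean G := by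
  simp [signMean, sum_add_distrib, add_div]

theorem signMean_const_mul (c : ℝ) (F : (ι → ℤˣ) → ℝ) :
    signMean (fun ω => c * F ω) = c * signMean F := by
  simp [signMean, ← mul_sum, mul_div_assoc]

theorem signMean_const (c : ℝ) : signMean (fun _ : ι → ℤˣ => c) = c := by
  have := (card_signs_pos (ι := ι)).ne'
  simp only [signMean, sum_const, card_univ, nsmul_eq_mul]
  field_simp

theorem signMean_sum {κ : Type} (s : Finset κ) (F : κ → (ι → ℤˣ) → ℝ) :
    signMean (fun ω => ∑ k ∈ s, F k ω) = ∑ k ∈ s, signMean (F k) := by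
  simp only [signMean]
  rw [sum_comm, sum_div]

theorem signMean_nonneg {F : (ι → ℤˣ) → ℝ} (h : ∀ ω, 0 ≤ F ω) : 0 ≤ signMean F :=
  div_nonneg (sum_nonneg fun ω _ => h ω) card_signs_pos.le

theorem signMean_flipSign (k : ι) (F : (ι → ℤˣ) → ℝ) :
    signMean (fun ω => F (flipSign k ω)) = signMean F := by
  unfold signMean
  congr 1
  exact Equiv.sum_comp (Equiv.mulRight (Pi.mulSingle k (-1) : ι → ℤˣ)) F

theorem signMean_rsign_mul_rsign {i j : ι} (h : i ≠ j) :
    signMean (fun ω => rsign i ω * rsign j ω) = 0 := by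
  have := signMean_flipSign i (fun ω => rsign i ω * rsign j ω)
  have e : (fun ω => rsign i (flipSign i ω) * rsign j (flipSign i ω)) =
      fun ω => (-1) * (rsign i ω * rsign j ω) := by
    funext ω
    simp [rsign, flipSign_self, flipSign_of_ne h.symm]
  rw [e, signMean_const_mul] at this
  linarith

theorem eq_zero_of_signMean_pow_le {f : (ι → ℤˣ) → ℝ} (hf : ∀ ω, 0 ≤ f ω) {q : ℕ} (hq : q ≠ 0)
    (h : signMean (fun ω => f ω ^ q) ≤ 0 ^ q) (ω : ι → ℤˣ) : f ω = 0 := by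
  rw [zero_pow hq, signMean, div_le_iff₀ card_signs_pos, zero_mul] at h
  have h1 : ∑ ω, f ω ^ q = 0 := le_antisymm h (sum_nonneg fun ω _ => pow_nonneg (hf ω) q)
  exact pow_eq_zero_iff hq |>.1
    ((sum_eq_zero_iff_of_nonneg fun ω _ => pow_nonneg (hf ω) q).1 h1 ω (mem_univ ω))

/-- Minkowski's inequality for independent uniform signs. -/
theorem signMean_add_pow_le {f g : (ι → ℤˣ) → ℝ} (hf : ∀ ω, 0 ≤ f ω) (hg : ∀ ω, 0 ≤ g ω) {q : ℕ}
    (hq : q ≠ 0) {U W : ℝ} (hU : 0 ≤ U) (hW : 0 ≤ W) (h1 : signMean (fun ω => f ω ^ q) ≤ U ^ q)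
    (h2 : signMean (fun ω => g ω ^ q) ≤ W ^ q) :
    signMean (fun ω => (f ω + g ω) ^ q) ≤ (U + W) ^ q := by
  rcases hU.eq_or_lt with rfl | hU
  · simpa [eq_zero_of_signMean_pow_le hf hq h1] using h2
  rcases hW.eq_or_lt with rfl | hW
  · simpa [eq_zero_of_signMean_pow_le hg hq h2] using h1
  have hUW : 0 < U + W := by positivity
  -- Convexity of x ↦ x^q, applied to f/U and g/W with weights U/(U + W) and W/(U + W).
  have key : ∀ ω, (f ω + g ω) ^ q ≤ (U + W) ^ q *
      (U / (U + W) / U ^ q * f ω ^ q + W / (U + W) / W ^ q * g ω ^ q) := by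
    intro ω
    have hc := (convexOn_pow (𝕜 := ℝ) q).2 (Set.mem_Ici.2 (div_nonneg (hf ω) hU.le))
      (Set.mem_Ici.2 (div_nonneg (hg ω) hW.le)) (show 0 ≤ U / (U + W) by positivity)
      (show 0 ≤ W / (U + W) by positivity) (by field_simp)
    simp only [smul_eq_mul] at hc
    have e : U / (U + W) * (f ω / U) + W / (U + W) * (g ω / W) = (f ω + g ω) / (U + W) := by
      field_simp
    rw [e, div_pow, div_pow, div_pow, div_le_iff₀ (by positivity)] at hc
    refine hc.trans_eq ?_
    field_simp
  refine (signMean_mono key).trans ?_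
  rw [signMean_const_mul, signMean_add, signMean_const_mul, signMean_const_mul]
  calc _ ≤ (U + W) ^ q * (U / (U + W) / U ^ q * U ^ q + W / (U + W) / W ^ q * W ^ q) := by
        gcongr
    _ = _ := by field_simp

/-- The moment growth of a polynomial of degree `d` in independent signs with second moment at
most `V`. -/
def ChaosBound (d : ℕ) (V : ℝ) (F : (ι → ℤˣ) → ℝ) : Prop :=
  ∀ q : ℕ, 1 ≤ q → signMean (fun ω => F ω ^ (2 * q)) ≤ ((2 * q - 1 : ℝ) ^ d * V) ^ q

theorem ChaosBound.mono {d : ℕ} {V W : ℝ} {F : (ι → ℤˣ) → ℝ} (h : ChaosBound d V F) (hV : 0 ≤ V)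
    (hVW : V ≤ W) : ChaosBound d W F := by
  intro q hq
  have hq' : (1 : ℝ) ≤ q := by exact_mod_cast hq
  have : (0 : ℝ) ≤ (2 * q - 1 : ℝ) ^ d := pow_nonneg (by linarith) d
  refine (h q hq).trans (pow_le_pow_left₀ (by positivity) ?_ q)
  gcongr

theorem chaosBound_const (u : ℝ) : ChaosBound 0 (u ^ 2) (fun _ : ι → ℤˣ => u) := by
  intro q _
  rw [signMean_const, pow_zero, one_mul, pow_mul]

theorem chaosBound_zero (d : ℕ) : ChaosBound d 0 (fun _ : ι → ℤˣ => 0) := by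
  intro q hq
  rw [signMean_const, mul_zero, zero_pow (by omega), zero_pow (by omega)]

/-- F and G do not involve the k-th sign, so flipping it symmetrizes the moment into a two-point
average. The two-point inequality replaces it by F² + (2q - 1) G², and Minkowski's inequality
separates the two parts. Each new sign factor thus costs one power of 2q - 1. -/
theorem ChaosBound.add_rsign_mul {d : ℕ} {V W : ℝ} {F G : (ι → ℤˣ) → ℝ}
    (hF : ChaosBound (d + 1) V F) (hG : ChaosBound d W G) (hV : 0 ≤ V) (hW : 0 ≤ W) (k : ι)
    (hFk : ∀ ω, F (flipSign k ω) = F ω) (hGk : ∀ ω, G (flipSign k ω) = G ω) :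
    ChaosBound (d + 1) (V + W) (fun ω => F ω + rsign k ω * G ω) := by
  intro q hq
  have hq' : (1 : ℝ) ≤ q := by exact_mod_cast hq
  have hc : (0 : ℝ) ≤ 2 * q - 1 := by linarith
  have hsymm : signMean (fun ω => (F ω + rsign k ω * G ω) ^ (2 * q)) =
      signMean (fun ω => ((F ω + rsign k ω * G ω) ^ (2 * q) +
        (F ω - rsign k ω * G ω) ^ (2 * q)) / 2) := by
    have h1 := signMean_flipSign k (fun ω => (F ω + rsign k ω * G ω) ^ (2 * q))
    have h2 : (fun ω => (F (flipSign k ω) + rsign k (flipSign k ω) * G (flipSign k ω)) ^ (2 * q)) =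
        fun ω => (F ω - rsign k ω * G ω) ^ (2 * q) := by
      funext ω
      rw [hFk, hGk, rsign, flipSign_self, rsign]
      push_cast
      ring
    rw [h2] at h1
    simp_rw [add_div, div_eq_inv_mul]
    rw [signMean_add, signMean_const_mul, signMean_const_mul, h1]
    ring
  rw [hsymm, mul_add]
  refine (signMean_mono fun ω => two_point_hypercontractive _ _ q hq).trans ?_
  refine signMean_add_pow_le (fun ω => sq_nonneg _) (fun ω => by positivity) (by omega)
    (by positivity) (by positivity) ?_ ?_
  · simp_rw [← pow_mul]
    exact hF q hq
  · have e : (fun ω => ((2 * q - 1 : ℝ) * (rsign k ω * G ω) ^ 2) ^ q) =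
        fun ω => (2 * q - 1 : ℝ) ^ q * G ω ^ (2 * q) := by
      funext ω
      rw [mul_pow (rsign k ω), rsign_sq, one_mul, mul_pow, pow_mul]
    rw [e, signMean_const_mul, pow_succ, mul_comm ((2 * q - 1 : ℝ) ^ d), mul_assoc, mul_pow]
    gcongr
    exact hG q hq

theorem chaosBound_linear (u : ι → ℝ) (s : Finset ι) :
    ChaosBound 1 (∑ i ∈ s, u i ^ 2) (fun ω => ∑ i ∈ s, u i * rsign i ω) := by
  induction s using Finset.induction_on with
  | empty => simpa using chaosBound_zero 1
  | insert k s hk ih =>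
    have := ih.add_rsign_mul (chaosBound_const (u k)) (sum_nonneg fun _ _ => sq_nonneg _)
      (sq_nonneg _) k (fun ω => sum_congr rfl fun i hi => by
        rw [rsign_flipSign_of_ne (ne_of_mem_of_not_mem hi hk)]) (fun _ => rfl)
    convert this using 2
    · rw [sum_insert hk, add_comm]
    · rw [sum_insert hk, add_comm, mul_comm (u k)]

/-- The zero diagonal makes the form multilinear, so a new sign k enters only through a linear form
with coefficients B k i + B i k. As B need not be symmetric, (x + y)² ≤ 2 (x² + y²) produces the
factor 2. -/
theorem chaosBound_quadratic (B : ι → ι → ℝ) (hB : ∀ i, B i i = 0) (s : Finset ι) :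
    ChaosBound 2 (2 * ∑ i ∈ s, ∑ j ∈ s, B i j ^ 2)
      (fun ω => ∑ i ∈ s, ∑ j ∈ s, B i j * (rsign i ω * rsign j ω)) := by
  induction s using Finset.induction_on with
  | empty => simpa using chaosBound_zero 2
  | insert k s hk ih =>
    have hflip : ∀ i ∈ s, ∀ ω, rsign i (flipSign k ω) = rsign i ω := fun i hi =>
      rsign_flipSign_of_ne (ne_of_mem_of_not_mem hi hk)
    have := ih.add_rsign_mul (chaosBound_linear (fun i => B k i + B i k) s)
      (mul_nonneg zero_le_two (sum_nonneg fun _ _ => sum_nonneg fun _ _ => sq_nonneg _))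
      (sum_nonneg fun _ _ => sq_nonneg _) k
      (fun ω => sum_congr rfl fun i hi => sum_congr rfl fun j hj => by
        rw [hflip i hi, hflip j hj])
      (fun ω => sum_congr rfl fun i hi => by rw [hflip i hi])
    have e : (fun ω => ∑ i ∈ insert k s, ∑ j ∈ insert k s, B i j * (rsign i ω * rsign j ω)) =
        fun ω => ∑ i ∈ s, ∑ j ∈ s, B i j * (rsign i ω * rsign j ω) +
          rsign k ω * ∑ i ∈ s, (B k i + B i k) * rsign i ω := by
      funext ω
      simp only [sum_insert hk, hB, zero_mul, zero_add, sum_add_distrib, mul_sum, add_mul, mul_add]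
      have e1 : ∑ x ∈ s, B k x * (rsign k ω * rsign x ω) =
        ∑ x ∈ s, rsign k ω * (B k x * rsign x ω) := sum_congr rfl fun _ _ => by ring
      have e2 : ∑ x ∈ s, B x k * (rsign x ω * rsign k ω) =
        ∑ x ∈ s, rsign k ω * (B x k * rsign x ω) := sum_congr rfl fun _ _ => by ring
      rw [e1, e2]
      ring
    rw [e]
    refine this.mono (add_nonneg (mul_nonneg zero_le_two
      (sum_nonneg fun _ _ => sum_nonneg fun _ _ => sq_nonneg _))
      (sum_nonneg fun _ _ => sq_nonneg _)) ?_
    simp only [sum_insert hk, hB, sum_add_distrib]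
    have : ∑ i ∈ s, (B k i + B i k) ^ 2 ≤ 2 * (∑ i ∈ s, B k i ^ 2 + ∑ i ∈ s, B i k ^ 2) := by
      rw [← sum_add_distrib, mul_sum]
      exact sum_le_sum fun i _ => by nlinarith [sq_nonneg (B k i - B i k)]
    linarith

/-- The probability of an event about independent uniform signs. -/
noncomputable def signProb (S : Set (ι → ℤˣ)) : ℝ := signMean (S.indicator 1)

theorem signProb_mono {S T : Set (ι → ℤˣ)} (h : S ⊆ T) : signProb S ≤ signProb T :=
  signMean_mono fun ω => Set.indicator_le_indicator_of_subset h (fun _ => zero_le_one) ω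

theorem signProb_compl (S : Set (ι → ℤˣ)) : signProb S = 1 - signProb Sᶜ := by
  have h : signProb S + signProb Sᶜ = 1 := by
    rw [signProb, signProb, ← signMean_add, ← signMean_const (ι := ι) 1]
    congr 1
    funext ω
    exact congrFun (Set.indicator_self_add_compl S (1 : (ι → ℤˣ) → ℝ)) ω
  linarith

theorem signProb_iUnion_le {κ : Type} (s : Finset κ) (S : κ → Set (ι → ℤˣ)) :
    signProb (⋃ k ∈ s, S k) ≤ ∑ k ∈ s, signProb (S k) := by
  simp only [signProb]
  rw [← signMean_sum]
  refine signMean_mono fun ω => ?_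
  have h0 : ∀ k ∈ s, (0 : ℝ) ≤ (S k).indicator 1 ω := fun k _ =>
    Set.indicator_nonneg (fun _ _ => zero_le_one) ω
  by_cases h : ω ∈ ⋃ k ∈ s, S k
  · rw [Set.indicator_of_mem h]
    obtain ⟨k, hk, hω⟩ := Set.mem_iUnion₂.1 h
    refine le_trans ?_ (single_le_sum h0 hk)
    rw [Set.indicator_of_mem hω]
  · rw [Set.indicator_of_notMem h]
    exact sum_nonneg h0

theorem mul_signProb_le {F : (ι → ℤˣ) → ℝ} (hF : ∀ ω, 0 ≤ F ω) (t : ℝ) :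
    t * signProb {ω | t ≤ F ω} ≤ signMean F := by
  rw [signProb, ← signMean_const_mul]
  refine signMean_mono fun ω => ?_
  by_cases h : ω ∈ {ω | t ≤ F ω}
  · rw [Set.indicator_of_mem h]
    simpa using h
  · rw [Set.indicator_of_notMem h]
    simpa using hF ω

/-- Markov's inequality for the moment of order 2q with q = ⌊r⌋. The factor e in the hypothesis
leaves a bound exp(-2q). -/
theorem ChaosBound.tail {V : ℝ} {F : (ι → ℤˣ) → ℝ} (h : ChaosBound 2 V F) {r t : ℝ}
    (hr : 1 ≤ r) (ht : 0 < t) (hV : 0 ≤ V) (hrt : (2 * Real.exp 1 * r) ^ 2 * V ≤ t ^ 2) :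
    signProb {ω | t ≤ |F ω|} ≤ Real.exp (-r) := by
  set q := ⌊r⌋₊ with hq
  have hq1 : 1 ≤ q := Nat.one_le_floor_iff r |>.2 hr
  have hq1' : (1 : ℝ) ≤ q := by exact_mod_cast hq1
  have hqr : (q : ℝ) ≤ r := Nat.floor_le (by linarith)
  have hrq : r < q + 1 := Nat.lt_floor_add_one r
  have h1 := mul_signProb_le (F := fun ω => F ω ^ (2 * q))
    (fun ω => by rw [pow_mul]; positivity) (t ^ (2 * q))
  have h2 : signProb {ω | t ≤ |F ω|} ≤ signProb {ω | t ^ (2 * q) ≤ F ω ^ (2 * q)} := by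
    refine signProb_mono fun ω hω => ?_
    have : t ^ (2 * q) ≤ |F ω| ^ (2 * q) := pow_le_pow_left₀ ht.le hω _
    rwa [pow_mul |F ω|, sq_abs, ← pow_mul] at this
  have h3 : signMean (fun ω => F ω ^ (2 * q)) ≤ (t ^ 2 * Real.exp (-2)) ^ q := by
    refine (h q hq1).trans (pow_le_pow_left₀ (by positivity) ?_ q)
    have h4 : (2 * q - 1 : ℝ) ^ 2 ≤ (2 * r) ^ 2 := by
      refine pow_le_pow_left₀ (by linarith) (by linarith) 2
    have h5 : Real.exp 1 ^ 2 * Real.exp (-2) = 1 := by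
      rw [← Real.exp_nat_mul, ← Real.exp_add]; simp
    calc (2 * q - 1 : ℝ) ^ 2 * V ≤ (2 * r) ^ 2 * V := by gcongr
      _ = ((2 * Real.exp 1 * r) ^ 2 * V) * Real.exp (-2) := by linear_combination (-(2 * r) ^ 2 * V) * h5
      _ ≤ _ := by gcongr
  have h6 : signProb {ω | t ^ (2 * q) ≤ F ω ^ (2 * q)} ≤ Real.exp (-2) ^ q := by
    have h7 := h1.trans h3
    rw [mul_pow, ← pow_mul] at h7
    exact le_of_mul_le_mul_left h7 (by positivity)
  refine (h2.trans h6).trans ?_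
  rw [← Real.exp_nat_mul]
  -- Here 2q ≥ q + 1 > r, because q ≥ 1.
  exact Real.exp_le_exp.2 (by linarith)

theorem uniformOfFintype_toOuterMeasure_eq (S : Set (ι → ℤˣ)) :
    (PMF.uniformOfFintype (ι → ℤˣ)).toOuterMeasure S = ENNReal.ofReal (signProb S) := by
  classical
  rw [PMF.toOuterMeasure_uniformOfFintype_apply, signProb, signMean]
  have : (∑ ω, S.indicator (1 : (ι → ℤˣ) → ℝ) ω) = Fintype.card S := by
    simp [Set.indicator_apply, Fintype.card_subtype]
  rw [this, ENNReal.ofReal_div_of_pos card_signs_pos]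
  simp

end Rademacher

/-! ### The Jackson kernel: positivity and concentration -/

section KernelPolynomial

open Finset Polynomial.Chebyshev

/-- The integral of `f` against the Chebyshev weight. -/
noncomputable def chebyshevIntegral (f : ℝ → ℝ) : ℝ := ∫ θ in (0 : ℝ)..Real.pi, f (Real.cos θ)

theorem intervalIntegrable_comp_cos {f : ℝ → ℝ} (hf : Continuous f) :
    IntervalIntegrable (fun θ => f (Real.cos θ)) MeasureTheory.volume 0 Real.pi :=
  (hf.comp Real.continuous_cos).intervalIntegrable _ _

theorem chebyshevIntegral_eq (f : ℝ → ℝ) :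
    ∫ x in (-1 : ℝ)..1, f x * chebyshevWeight x = chebyshevIntegral f := by
  rw [chebyshevIntegral, ← integral_measureT_eq_integral_cos, integral_measureT]
  simp [chebyshevWeight]

theorem chebyshevIntegral_add {f g : ℝ → ℝ} (hf : Continuous f) (hg : Continuous g) :
    chebyshevIntegral (fun x => f x + g x) = chebyshevIntegral f + chebyshevIntegral g :=
  intervalIntegral.integral_add (intervalIntegrable_comp_cos hf) (intervalIntegrable_comp_cos hg)

theorem chebyshevIntegral_sub {f g : ℝ → ℝ} (hf : Continuous f) (hg : Continuous g) :
    chebyshevIntegral (fun x => f x - g x) = chebyshevIntegral f - chebyshevIntegral g :=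
  intervalIntegral.integral_sub (intervalIntegrable_comp_cos hf) (intervalIntegrable_comp_cos hg)

theorem chebyshevIntegral_const_mul (c : ℝ) (f : ℝ → ℝ) :
    chebyshevIntegral (fun x => c * f x) = c * chebyshevIntegral f :=
  intervalIntegral.integral_const_mul _ _

theorem chebyshevIntegral_const (c : ℝ) : chebyshevIntegral (fun _ => c) = Real.pi * c := by
  simp [chebyshevIntegral]

theorem chebyshevIntegral_sum {κ : Type} (s : Finset κ) {f : κ → ℝ → ℝ}
    (hf : ∀ k, Continuous (f k)) :
    chebyshevIntegral (fun x => ∑ k ∈ s, f k x) = ∑ k ∈ s, chebyshevIntegral (f k) :=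
  intervalIntegral.integral_finsetSum fun k _ => intervalIntegrable_comp_cos (hf k)

theorem chebyshevIntegral_mono {f g : ℝ → ℝ} (hf : Continuous f) (hg : Continuous g)
    (h : ∀ x ∈ Set.Icc (-1 : ℝ) 1, f x ≤ g x) : chebyshevIntegral f ≤ chebyshevIntegral g :=
  intervalIntegral.integral_mono_on Real.pi_pos.le (intervalIntegrable_comp_cos hf)
    (intervalIntegrable_comp_cos hg) fun _ _ => h _ (Real.cos_mem_Icc _)

theorem chebyshevIntegral_comp_neg (f : ℝ → ℝ) :
    chebyshevIntegral (fun x => f (-x)) = chebyshevIntegral f := by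
  have := intervalIntegral.integral_comp_sub_left (a := 0) (b := Real.pi)
    (fun θ => f (Real.cos θ)) Real.pi
  simpa [chebyshevIntegral, Real.cos_pi_sub] using this

theorem chebyshevIntegral_T_mul_T {k l : ℕ} (hk : k ≠ 0) :
    chebyshevIntegral (fun x => (T ℝ k).eval x * (T ℝ l).eval x) =
      if k = l then Real.pi / 2 else 0 := by
  rw [chebyshevIntegral, ← integral_measureT_eq_integral_cos
    (f := fun x => (T ℝ k).eval x * (T ℝ l).eval x)]
  split_ifs with h
  · subst h
    exact integral_T_real_mul_self_measureT_of_ne_zero hk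
  · exact integral_eval_T_real_mul_eval_T_real_measureT_of_ne h

theorem chebyshevIntegral_T {k : ℕ} (hk : k ≠ 0) :
    chebyshevIntegral (fun x => (T ℝ k).eval x) = 0 := by
  have := chebyshevIntegral_T_mul_T (l := 0) hk
  simpa [hk] using this

/-- The normalized Jackson coefficient. -/
noncomputable def jacksonRatio (h k : ℕ) : ℝ := jacksonCoeff h k / jacksonCoeff h 0

/-- The density, relative to the Chebyshev weight, of the Jackson approximation of degree `2 h` of a
point mass at `y`. -/
noncomputable def jacksonKernel (h : ℕ) (y x : ℝ) : ℝ :=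
  (1 + 2 * ∑ k ∈ range (2 * h),
    jacksonRatio h (k + 1) * (T ℝ (k + 1 : ℕ)).eval y * (T ℝ (k + 1 : ℕ)).eval x) / Real.pi

@[fun_prop]
theorem continuous_jacksonKernel (h : ℕ) (y : ℝ) : Continuous (jacksonKernel h y) := by
  unfold jacksonKernel
  fun_prop

theorem jacksonRatio_mul_T_mul_T (h k : ℕ) (a t : ℝ) :
    2 * jacksonCoeff h 0 *
        (jacksonRatio h k * (T ℝ k).eval (Real.cos a) * (T ℝ k).eval (Real.cos t)) =
      jacksonCoeff h k * Real.cos (k * (t - a)) + jacksonCoeff h k * Real.cos (k * (t + a)) := by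
  have e : jacksonRatio h k * jacksonCoeff h 0 = jacksonCoeff h k :=
    div_mul_cancel₀ _ (jacksonCoeff_zero_pos h).ne'
  rw [T_real_cos, T_real_cos, mul_sub, mul_add, Real.cos_sub, Real.cos_add, ← e, Int.cast_natCast]
  ring

/-- With y = cos a and x = cos t, the product formula for cosines writes the kernel as a positive
multiple of the sum of the nonnegative Jackson polynomial at t - a and at t + a. -/
theorem jacksonKernel_nonneg (h : ℕ) {y x : ℝ} (hy : y ∈ Set.Icc (-1 : ℝ) 1)
    (hx : x ∈ Set.Icc (-1 : ℝ) 1) : 0 ≤ jacksonKernel h y x := by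
  have h0 := jacksonCoeff_zero_pos h
  obtain ⟨a, rfl⟩ : ∃ a, Real.cos a = y := ⟨Real.arccos y, Real.cos_arccos hy.1 hy.2⟩
  obtain ⟨t, rfl⟩ : ∃ t, Real.cos t = x := ⟨Real.arccos x, Real.cos_arccos hx.1 hx.2⟩
  refine div_nonneg ?_ Real.pi_pos.le
  refine nonneg_of_mul_nonneg_right (a := 2 * jacksonCoeff h 0) ?_ (by positivity)
  have h1 := jacksonCoeff_cos_sum_nonneg h (t - a)
  have h2 := jacksonCoeff_cos_sum_nonneg h (t + a)
  have e : 2 * jacksonCoeff h 0 * ∑ k ∈ range (2 * h), jacksonRatio h (k + 1) *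
      (T ℝ (k + 1 : ℕ)).eval (Real.cos a) * (T ℝ (k + 1 : ℕ)).eval (Real.cos t) =
      ∑ k ∈ range (2 * h), jacksonCoeff h (k + 1) * Real.cos ((k + 1 : ℕ) * (t - a)) +
        ∑ k ∈ range (2 * h), jacksonCoeff h (k + 1) * Real.cos ((k + 1 : ℕ) * (t + a)) := by
    rw [mul_sum, ← sum_add_distrib]
    exact sum_congr rfl fun k _ => jacksonRatio_mul_T_mul_T h (k + 1) a t
  rw [mul_add, mul_left_comm, e]
  linarith

theorem chebyshevIntegral_mul_jacksonKernel (h : ℕ) (y : ℝ) {g : ℝ → ℝ} (hg : Continuous g) :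
    chebyshevIntegral (fun x => g x * jacksonKernel h y x) =
      (chebyshevIntegral g + 2 * ∑ k ∈ range (2 * h), jacksonRatio h (k + 1) *
        (T ℝ (k + 1 : ℕ)).eval y *
          chebyshevIntegral (fun x => g x * (T ℝ (k + 1 : ℕ)).eval x)) / Real.pi := by
  have e : (fun x => g x * jacksonKernel h y x) = fun x => (1 / Real.pi) * (g x +
      2 * ∑ k ∈ range (2 * h), jacksonRatio h (k + 1) * (T ℝ (k + 1 : ℕ)).eval y *
        (g x * (T ℝ (k + 1 : ℕ)).eval x)) := by
    funext x
    have : ∑ k ∈ range (2 * h), jacksonRatio h (k + 1) * (T ℝ (k + 1 : ℕ)).eval y *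
        (g x * (T ℝ (k + 1 : ℕ)).eval x) = g x * ∑ k ∈ range (2 * h), jacksonRatio h (k + 1) *
          (T ℝ (k + 1 : ℕ)).eval y * (T ℝ (k + 1 : ℕ)).eval x := by
      rw [mul_sum]
      exact sum_congr rfl fun _ _ => by ring
    rw [this, jacksonKernel]
    ring
  rw [e, chebyshevIntegral_const_mul, chebyshevIntegral_add hg (by fun_prop),
    chebyshevIntegral_const_mul, chebyshevIntegral_sum _ (fun k => by fun_prop)]
  simp_rw [chebyshevIntegral_const_mul]
  ring

theorem chebyshevIntegral_jacksonKernel (h : ℕ) (y : ℝ) :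
    chebyshevIntegral (jacksonKernel h y) = 1 := by
  have := chebyshevIntegral_mul_jacksonKernel h y (g := fun _ => 1) continuous_const
  simp only [one_mul] at this
  rw [show jacksonKernel h y = fun x => jacksonKernel h y x from rfl, this, chebyshevIntegral_const,
    sum_eq_zero fun k _ => by rw [chebyshevIntegral_T (Nat.succ_ne_zero k), mul_zero]]
  have := Real.pi_pos.ne'
  field_simp
  ring

theorem chebyshevIntegral_T_mul_jacksonKernel {h k : ℕ} (hk : k < 2 * h) (y : ℝ) :
    chebyshevIntegral (fun x => (T ℝ (k + 1 : ℕ)).eval x * jacksonKernel h y x) =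
      jacksonRatio h (k + 1) * (T ℝ (k + 1 : ℕ)).eval y := by
  rw [chebyshevIntegral_mul_jacksonKernel h y (by fun_prop),
    chebyshevIntegral_T (Nat.succ_ne_zero k)]
  simp_rw [chebyshevIntegral_T_mul_T (Nat.succ_ne_zero k)]
  rw [sum_eq_single k]
  · have := Real.pi_pos.ne'
    simp
    field_simp
  · intro l _ hl
    simp [hl.symm]
  · intro hk'
    exact absurd (mem_range.2 hk) hk'

theorem chebyshevIntegral_mul_jacksonKernel_mono (h : ℕ) {y : ℝ} (hy : y ∈ Set.Icc (-1 : ℝ) 1)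
    {f g : ℝ → ℝ} (hf : Continuous f) (hg : Continuous g)
    (hfg : ∀ x ∈ Set.Icc (-1 : ℝ) 1, f x ≤ g x) :
    chebyshevIntegral (fun x => f x * jacksonKernel h y x) ≤
      chebyshevIntegral (fun x => g x * jacksonKernel h y x) :=
  chebyshevIntegral_mono (by fun_prop) (by fun_prop) fun x hx =>
    mul_le_mul_of_nonneg_right (hfg x hx) (jacksonKernel_nonneg h hy hx)

/-- At y = 1 the ratio is the mean of a Chebyshev polynomial, bounded by 1, under a probability
density. -/
theorem abs_jacksonRatio_le_one {h k : ℕ} (hk : k < 2 * h) : |jacksonRatio h (k + 1)| ≤ 1 := by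
  have h1 := chebyshevIntegral_T_mul_jacksonKernel hk 1
  rw [T_eval_one, mul_one] at h1
  have hT : ∀ x ∈ Set.Icc (-1 : ℝ) 1, |(T ℝ (k + 1 : ℕ)).eval x| ≤ 1 := fun x hx =>
    abs_eval_T_real_le_one _ (abs_le.2 hx)
  have h2 := chebyshevIntegral_jacksonKernel h 1
  have m : (1 : ℝ) ∈ Set.Icc (-1 : ℝ) 1 := by simp
  rw [abs_le, ← h1]
  constructor
  · have := chebyshevIntegral_mul_jacksonKernel_mono h m (f := fun _ => -1)
      (g := fun x => (T ℝ (k + 1 : ℕ)).eval x) (by fun_prop) (by fun_prop)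
      fun x hx => (abs_le.1 (hT x hx)).1
    rwa [chebyshevIntegral_const_mul, h2, mul_one] at this
  · have := chebyshevIntegral_mul_jacksonKernel_mono h m (g := fun _ => 1)
      (f := fun x => (T ℝ (k + 1 : ℕ)).eval x) (by fun_prop) (by fun_prop)
      fun x hx => (abs_le.1 (hT x hx)).2
    rwa [chebyshevIntegral_const_mul, h2, mul_one] at this

theorem one_sub_jacksonRatio_one_le (h : ℕ) : 1 - jacksonRatio h 1 ≤ 3 / (h + 1 : ℝ) ^ 2 :=
  one_sub_jacksonCoeff_ratio_le h

theorem chebyshevIntegral_id_mul_jacksonKernel {h : ℕ} (hh : 1 ≤ h) (y : ℝ) :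
    chebyshevIntegral (fun x => x * jacksonKernel h y x) = jacksonRatio h 1 * y := by
  simpa using chebyshevIntegral_T_mul_jacksonKernel (h := h) (k := 0) (by omega) y

theorem chebyshevIntegral_sq_mul_jacksonKernel {h : ℕ} (hh : 1 ≤ h) (y : ℝ) :
    chebyshevIntegral (fun x => x ^ 2 * jacksonKernel h y x) =
      (1 + jacksonRatio h 2 * (2 * y ^ 2 - 1)) / 2 := by
  have h1 := chebyshevIntegral_T_mul_jacksonKernel (h := h) (k := 1) (by omega) y
  have e : ∀ x : ℝ, (T ℝ (1 + 1 : ℕ)).eval x = 2 * x ^ 2 - 1 := fun x => by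
    simp [T_two]
  simp_rw [e] at h1
  have e2 : (fun x => x ^ 2 * jacksonKernel h y x) = fun x =>
      (1 / 2) * ((2 * x ^ 2 - 1) * jacksonKernel h y x + jacksonKernel h y x) := by
    funext x; ring
  rw [e2, chebyshevIntegral_const_mul, chebyshevIntegral_add (by fun_prop) (by fun_prop), h1,
    chebyshevIntegral_jacksonKernel]
  ring

/-- The tangent bound x² ≥ 2x - 1 is integrated against the kernel at y = 1. -/
theorem one_sub_jacksonRatio_two_le {h : ℕ} (hh : 1 ≤ h) :
    1 - jacksonRatio h 2 ≤ 4 * (1 - jacksonRatio h 1) := by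
  have h1 := chebyshevIntegral_id_mul_jacksonKernel hh 1
  have h2 := chebyshevIntegral_sq_mul_jacksonKernel hh 1
  have h3 := chebyshevIntegral_mul_jacksonKernel_mono h (y := 1) (by simp) (f := fun x => 2 * x - 1)
    (g := fun x => x ^ 2) (by fun_prop) (by fun_prop) fun x _ => by nlinarith [sq_nonneg (x - 1)]
  have e : (fun x => (2 * x - 1) * jacksonKernel h 1 x) = fun x =>
      2 * (x * jacksonKernel h 1 x) - jacksonKernel h 1 x := by funext x; ring
  rw [e, chebyshevIntegral_sub (by fun_prop) (by fun_prop), chebyshevIntegral_const_mul, h1, h2,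
    chebyshevIntegral_jacksonKernel] at h3
  linarith

/-- The mean displacement is reduced to the second moment by |u| ≤ 2/M + M u²/8. The second moment
is O(1/M²) since the first two ratios are that close to 1. -/
theorem chebyshevIntegral_abs_sub_mul_jacksonKernel_le {h : ℕ} (hh : 1 ≤ h) {y : ℝ}
    (hy : y ∈ Set.Icc (-1 : ℝ) 1) :
    chebyshevIntegral (fun x => |y - x| * jacksonKernel h y x) ≤ 4 / (h + 1 : ℝ) := by
  have hpos : (0 : ℝ) < h + 1 := by positivity
  set M : ℝ := h + 1 with hM
  have h1 := chebyshevIntegral_id_mul_jacksonKernel hh y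
  have h2 := chebyshevIntegral_sq_mul_jacksonKernel hh y
  have h3 := chebyshevIntegral_mul_jacksonKernel_mono h hy (f := fun x => |y - x|)
    (g := fun x => 2 / M + M / 8 * (y - x) ^ 2) (by fun_prop) (by fun_prop) fun x _ => by
      rw [← sq_abs (y - x), ← sub_nonneg]
      have : 2 / M + M / 8 * |y - x| ^ 2 - |y - x| = (4 - M * |y - x|) ^ 2 / (8 * M) := by
        field_simp; ring
      rw [this]; positivity
  have e : (fun x => (2 / M + M / 8 * (y - x) ^ 2) * jacksonKernel h y x) = fun x =>
      (2 / M + M / 8 * y ^ 2) * jacksonKernel h y x + (-(M / 4 * y) * (x * jacksonKernel h y x) +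
        M / 8 * (x ^ 2 * jacksonKernel h y x)) := by funext x; ring
  rw [e, chebyshevIntegral_add (by fun_prop) (by fun_prop),
    chebyshevIntegral_add (by fun_prop) (by fun_prop), chebyshevIntegral_const_mul,
    chebyshevIntegral_const_mul, chebyshevIntegral_const_mul, h1, h2,
    chebyshevIntegral_jacksonKernel] at h3
  refine h3.trans ?_
  have r1 := one_sub_jacksonRatio_one_le h
  have r2 := one_sub_jacksonRatio_two_le hh
  have r3 := (abs_le.1 (abs_jacksonRatio_le_one (h := h) (k := 1) (by omega))).2
  simp only [Nat.reduceAdd] at r3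
  have hy2 : y ^ 2 ≤ 1 := (sq_le_one_iff_abs_le_one y).2 (abs_le.2 hy)
  -- The left side is the second moment of y - x under the kernel.
  have r4 : y ^ 2 * (1 - 2 * jacksonRatio h 1 + jacksonRatio h 2) + (1 - jacksonRatio h 2) / 2 ≤
      12 / M ^ 2 := by
    have r5 : 0 ≤ 1 - jacksonRatio h 1 := by
      have := (abs_le.1 (abs_jacksonRatio_le_one (h := h) (k := 0) (by omega))).2
      simp only [zero_add] at this
      linarith
    have : 12 / M ^ 2 = 4 * (3 / M ^ 2) := by ring
    nlinarith [sq_nonneg y]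
  calc _ = 2 / M + M / 8 * (y ^ 2 * (1 - 2 * jacksonRatio h 1 + jacksonRatio h 2) +
        (1 - jacksonRatio h 2) / 2) := by ring
    _ ≤ 2 / M + M / 8 * (12 / M ^ 2) := by gcongr
    _ ≤ 4 / M := by
      rw [← sub_nonneg]
      have : 4 / M - (2 / M + M / 8 * (12 / M ^ 2)) = 1 / (2 * M) := by field_simp; ring
      rw [this]; positivity

end KernelPolynomial

/-! ### Wasserstein bounds for the smeared measure -/

section Transport

open Finset Polynomial.Chebyshev

theorem integral_spectralDensity {𝕜 : Type} [RCLike 𝕜] {n : ℕ} {A : Matrix (Fin n) (Fin n) 𝕜}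
    (hA : A.IsHermitian) (f : ℝ → ℝ) :
    ∫ x, f x ∂(spectralDensity hA) = (∑ i, f (hA.eigenvalues i)) / n := by
  rw [spectralDensity, MeasureTheory.integral_smul_measure,
    MeasureTheory.integral_finsetSum_measure fun i _ => MeasureTheory.integrable_dirac (by simp)]
  simp [div_eq_inv_mul]

variable {n : ℕ}

/-- The density, relative to the Chebyshev weight, of the Jackson approximation of degree `2 h` of
the measure with masses `m` at the points `y`, mixed with the Chebyshev distribution. -/
noncomputable def dampedDensity (h : ℕ) (s : ℝ) (y m : Fin n → ℝ) (x : ℝ) : ℝ :=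
  (∑ j, m j * jacksonKernel h (y j) x + s / Real.pi) / (1 + s)

@[fun_prop]
theorem continuous_dampedDensity (h : ℕ) (s : ℝ) (y m : Fin n → ℝ) :
    Continuous (dampedDensity h s y m) := by
  unfold dampedDensity
  fun_prop

theorem integral_mul_dampedDensity (h : ℕ) (s : ℝ) (y m : Fin n → ℝ) {f : ℝ → ℝ}
    (hf : Continuous f) :
    ∫ x in (-1 : ℝ)..1, f x * (dampedDensity h s y m x * chebyshevWeight x) =
      (∑ j, m j * chebyshevIntegral (fun x => f x * jacksonKernel h (y j) x) +
        s * (chebyshevIntegral f / Real.pi)) / (1 + s) := by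
  simp_rw [← mul_assoc]
  rw [chebyshevIntegral_eq]
  have e : (fun x => f x * dampedDensity h s y m x) = fun x => (1 / (1 + s)) *
      (∑ j, m j * (f x * jacksonKernel h (y j) x) + s / Real.pi * f x) := by
    funext x
    have : ∑ j, m j * (f x * jacksonKernel h (y j) x) =
        f x * ∑ j, m j * jacksonKernel h (y j) x := by
      rw [mul_sum]
      exact sum_congr rfl fun _ _ => by ring
    rw [this, dampedDensity]
    ring
  rw [e, chebyshevIntegral_const_mul, chebyshevIntegral_add (by fun_prop) (by fun_prop),
    chebyshevIntegral_sum _ (fun j => by fun_prop), chebyshevIntegral_const_mul]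
  simp_rw [chebyshevIntegral_const_mul]
  ring

theorem isProbabilityDensity_dampedDensity (h : ℕ) {s : ℝ} (hs : 0 ≤ s) {y m : Fin n → ℝ}
    (hy : ∀ j, y j ∈ Set.Icc (-1 : ℝ) 1) (hm : ∀ j, 0 ≤ m j) (hm1 : ∑ j, m j = 1) :
    IsProbabilityDensity (fun x => dampedDensity h s y m x * chebyshevWeight x) := by
  refine ⟨fun x hx => ?_, ?_, ?_⟩
  · refine mul_nonneg (div_nonneg (add_nonneg (sum_nonneg fun j _ => ?_) ?_) (by linarith)) ?_
    · exact mul_nonneg (hm j) (jacksonKernel_nonneg h (hy j) hx)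
    · exact div_nonneg hs Real.pi_pos.le
    · unfold chebyshevWeight; positivity
  · have := intervalIntegrable_sqrt_one_sub_sq_inv.continuousOn_mul
      (continuous_dampedDensity h s y m).continuousOn
    simpa [chebyshevWeight] using this
  · have := integral_mul_dampedDensity h s y m (f := fun _ => 1) continuous_const
    simp only [one_mul] at this
    rw [this]
    simp_rw [show ∀ j, (fun x => jacksonKernel h (y j) x) = jacksonKernel h (y j) from fun _ => rfl,
      chebyshevIntegral_jacksonKernel, chebyshevIntegral_const]
    have := Real.pi_pos.ne'
    have : 1 + s ≠ 0 := by positivity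
    simp only [mul_one, hm1]
    field_simp

theorem sub_integral_mul_dampedDensity (hn : 0 < n) (h : ℕ) {s : ℝ} (hs : 0 ≤ s) (y m : Fin n → ℝ)
    {f : ℝ → ℝ} (hf : Continuous f) :
    (∑ i, f (y i)) / n - ∫ x in (-1 : ℝ)..1, f x * (dampedDensity h s y m x * chebyshevWeight x) =
      (((∑ i, f (y i)) / n - ∑ j, m j * chebyshevIntegral (fun x => f x * jacksonKernel h (y j) x)) +
        s * ((∑ i, f (y i)) / n - chebyshevIntegral f / Real.pi)) / (1 + s) := by
  rw [integral_mul_dampedDensity h s y m hf]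
  have : 1 + s ≠ 0 := by positivity
  field_simp
  ring

theorem wasserstein1_le {𝕜 : Type} [RCLike 𝕜] {A : Matrix (Fin n) (Fin n) 𝕜}
    (hA : A.IsHermitian) {q : ℝ → ℝ} {B : ℝ}
    (hq : ∀ f : ℝ → ℝ, LipschitzWith 1 f →
      (∑ i, f (hA.eigenvalues i)) / n - ∫ x in (-1 : ℝ)..1, f x * q x ≤ B) :
    wasserstein1 (spectralDensity hA) q ≤ ENNReal.ofReal B := by
  refine iSup₂_le fun f hf => ENNReal.ofReal_le_ofReal ?_
  rw [integral_spectralDensity]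
  exact hq f hf

theorem LipschitzWith.abs_sub_le {f : ℝ → ℝ} (hf : LipschitzWith 1 f) (x y : ℝ) :
    |f x - f y| ≤ |x - y| := by
  simpa [Real.dist_eq] using hf.dist_le_mul x y

theorem LipschitzWith.sub_le {f : ℝ → ℝ} (hf : LipschitzWith 1 f) (x y : ℝ) :
    f x - f y ≤ |x - y| :=
  (le_abs_self _).trans (hf.abs_sub_le x y)

theorem abs_chebyshevIntegral_le {g : ℝ → ℝ} (hg : Continuous g)
    (h : ∀ x ∈ Set.Icc (-1 : ℝ) 1, |g x| ≤ 1) : |chebyshevIntegral g| ≤ Real.pi := by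
  have h1 := chebyshevIntegral_mono hg continuous_const fun x hx => (abs_le.1 (h x hx)).2
  have h2 := chebyshevIntegral_mono continuous_const hg fun x hx => (abs_le.1 (h x hx)).1
  rw [chebyshevIntegral_const] at h1 h2
  exact abs_le.2 ⟨by linarith, by linarith⟩

theorem sub_chebyshevIntegral_mul_jacksonKernel_le {h : ℕ} (hh : 1 ≤ h) {y : ℝ}
    (hy : y ∈ Set.Icc (-1 : ℝ) 1) {f : ℝ → ℝ} (hf : LipschitzWith 1 f) :
    f y - chebyshevIntegral (fun x => f x * jacksonKernel h y x) ≤ 4 / (h + 1 : ℝ) := by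
  have hc := hf.continuous
  refine le_trans ?_ (chebyshevIntegral_abs_sub_mul_jacksonKernel_le hh hy)
  have h1 := chebyshevIntegral_mul_jacksonKernel_mono h hy (f := fun x => f y - f x)
    (g := fun x => |y - x|) (by fun_prop) (by fun_prop) fun x _ => hf.sub_le y x
  simp_rw [sub_mul] at h1
  rwa [chebyshevIntegral_sub (by fun_prop) (by fun_prop), chebyshevIntegral_const_mul,
    chebyshevIntegral_jacksonKernel, mul_one] at h1

/-- The effect of a perturbation of the masses on the integrals of a function against the Jackson
approximation. -/
theorem sum_mul_chebyshevIntegral_mul_jacksonKernel_le (h : ℕ) {y : Fin n → ℝ} {d : Fin n → ℝ}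
    (hd : ∑ j, d j = 0) {η : ℝ}
    (hη : ∀ k < 2 * h, |∑ j, d j * (T ℝ (k + 1 : ℕ)).eval (y j)| ≤ η)
    {f : ℝ → ℝ} (hf : LipschitzWith 1 f) :
    ∑ j, d j * chebyshevIntegral (fun x => f x * jacksonKernel h (y j) x) ≤
      2 * ((2 * h : ℕ) * η) := by
  have hc := hf.continuous
  -- Since d has total mass 0, a constant may be subtracted from f; the choice f 0 gives |g| ≤ 1 on
  -- [-1, 1].
  set g : ℝ → ℝ := fun x => f x - f 0 with hg
  have hgc : Continuous g := by fun_prop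
  have hg1 : ∀ x ∈ Set.Icc (-1 : ℝ) 1, |g x| ≤ 1 := fun x hx => by
    have := hf.abs_sub_le x 0
    rw [sub_zero] at this
    exact this.trans (abs_le.2 hx)
  have e1 : ∀ j, chebyshevIntegral (fun x => f x * jacksonKernel h (y j) x) =
      f 0 + chebyshevIntegral (fun x => g x * jacksonKernel h (y j) x) := by
    intro j
    simp_rw [hg, sub_mul]
    rw [chebyshevIntegral_sub (by fun_prop) (by fun_prop), chebyshevIntegral_const_mul,
      chebyshevIntegral_jacksonKernel]
    ring
  set c : ℕ → ℝ := fun k => chebyshevIntegral (fun x => g x * (T ℝ (k + 1 : ℕ)).eval x) with hcdef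
  have e2 : ∑ j, d j * chebyshevIntegral (fun x => f x * jacksonKernel h (y j) x) =
      2 * ∑ k ∈ range (2 * h), jacksonRatio h (k + 1) * (c k / Real.pi) *
        ∑ j, d j * (T ℝ (k + 1 : ℕ)).eval (y j) := by
    have e3 : ∀ j, d j * chebyshevIntegral (fun x => f x * jacksonKernel h (y j) x) =
        d j * (f 0 + chebyshevIntegral g / Real.pi) + 2 * ∑ k ∈ range (2 * h),
          jacksonRatio h (k + 1) * (c k / Real.pi) * (d j * (T ℝ (k + 1 : ℕ)).eval (y j)) := by
      intro j
      rw [e1, chebyshevIntegral_mul_jacksonKernel h _ hgc]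
      have : ∑ k ∈ range (2 * h),
          jacksonRatio h (k + 1) * (c k / Real.pi) * (d j * (T ℝ (k + 1 : ℕ)).eval (y j)) =
          d j / Real.pi * ∑ k ∈ range (2 * h),
            jacksonRatio h (k + 1) * (T ℝ (k + 1 : ℕ)).eval (y j) * c k := by
        rw [mul_sum]
        exact sum_congr rfl fun _ _ => by ring
      rw [this]
      ring
    rw [sum_congr rfl fun j _ => e3 j, sum_add_distrib, ← sum_mul, hd, zero_mul, zero_add, ← mul_sum,
      sum_comm]
    simp_rw [mul_sum]
  rw [e2]
  refine mul_le_mul_of_nonneg_left ?_ zero_le_two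
  have e4 : ∀ k ∈ range (2 * h), jacksonRatio h (k + 1) * (c k / Real.pi) *
      ∑ j, d j * (T ℝ (k + 1 : ℕ)).eval (y j) ≤ η := by
    intro k hk
    have hk := mem_range.1 hk
    -- No decay of the Chebyshev coefficients in k is used; the uniform bound suffices.
    have hck : |c k| ≤ Real.pi := abs_chebyshevIntegral_le (by fun_prop) fun x hx => by
      rw [abs_mul]
      exact mul_le_one₀ (hg1 x hx) (abs_nonneg _) (abs_eval_T_real_le_one _ (abs_le.2 hx))
    have hck' : |c k / Real.pi| ≤ 1 := by
      rw [abs_div, abs_of_pos Real.pi_pos]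
      exact div_le_one_of_le₀ hck Real.pi_pos.le
    refine (le_abs_self _).trans ?_
    rw [abs_mul, abs_mul]
    calc _ ≤ 1 * η := by
          refine mul_le_mul ?_ (hη k hk) (abs_nonneg _) zero_le_one
          exact mul_le_one₀ (abs_jacksonRatio_le_one hk) (abs_nonneg _) hck'
      _ = η := one_mul η
  refine (sum_le_card_nsmul _ _ _ e4).trans_eq ?_
  simp

/-- Both averages lie within 1 of f 0. -/
theorem average_sub_chebyshevIntegral_le_two (hn : 0 < n) {y : Fin n → ℝ}
    (hy : ∀ j, y j ∈ Set.Icc (-1 : ℝ) 1) {f : ℝ → ℝ} (hf : LipschitzWith 1 f) :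
    (∑ i, f (y i)) / n - chebyshevIntegral f / Real.pi ≤ 2 := by
  have hc := hf.continuous
  have hn' : (0 : ℝ) < n := by exact_mod_cast hn
  have h1 : (∑ i, f (y i)) / n ≤ f 0 + 1 := by
    rw [div_le_iff₀ hn']
    refine (sum_le_card_nsmul _ _ (f 0 + 1) fun i _ => ?_).trans_eq ?_
    · have := hf.sub_le (y i) 0
      rw [sub_zero] at this
      have := this.trans (abs_le.2 (hy i))
      linarith
    · simp; ring
  have h2 : f 0 - 1 ≤ chebyshevIntegral f / Real.pi := by
    rw [le_div_iff₀ Real.pi_pos, mul_comm, ← chebyshevIntegral_const]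
    refine chebyshevIntegral_mono continuous_const hc fun x hx => ?_
    have := hf.sub_le 0 x
    rw [zero_sub, abs_neg] at this
    have := this.trans (abs_le.2 hx)
    linarith
  linarith

theorem sub_integral_dampedDensity_le_of_moments (hn : 0 < n) {h : ℕ} (hh : 1 ≤ h) {s : ℝ}
    (hs : 0 ≤ s) {y m : Fin n → ℝ} (hy : ∀ j, y j ∈ Set.Icc (-1 : ℝ) 1) (hm1 : ∑ j, m j = 1)
    {η : ℝ} (hη : ∀ k < 2 * h, |∑ j, ((n : ℝ)⁻¹ - m j) * (T ℝ (k + 1 : ℕ)).eval (y j)| ≤ η)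
    {f : ℝ → ℝ} (hf : LipschitzWith 1 f) :
    (∑ i, f (y i)) / n - ∫ x in (-1 : ℝ)..1, f x * (dampedDensity h s y m x * chebyshevWeight x) ≤
      4 / (h + 1 : ℝ) + 2 * ((2 * h : ℕ) * η) + 2 * s := by
  have hc := hf.continuous
  have hn' : (0 : ℝ) < n := by exact_mod_cast hn
  have hη0 : 0 ≤ η := (abs_nonneg _).trans (hη 0 (by omega))
  rw [sub_integral_mul_dampedDensity hn h hs y m hc]
  have h1 := average_sub_chebyshevIntegral_le_two hn hy hf
  have h2 := sum_mul_chebyshevIntegral_mul_jacksonKernel_le h (y := y)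
    (d := fun j => (n : ℝ)⁻¹ - m j) (by simp [hm1, hn'.ne']) hη hf
  have h3 : (∑ i, f (y i)) / n -
      ∑ j, m j * chebyshevIntegral (fun x => f x * jacksonKernel h (y j) x) =
      ∑ i, (n : ℝ)⁻¹ * (f (y i) - chebyshevIntegral (fun x => f x * jacksonKernel h (y i) x)) +
        ∑ j, ((n : ℝ)⁻¹ - m j) * chebyshevIntegral (fun x => f x * jacksonKernel h (y j) x) := by
    rw [← sum_add_distrib, sum_div, ← sum_sub_distrib]
    exact sum_congr rfl fun _ _ => by ring
  have h4 : ∑ i, (n : ℝ)⁻¹ * (f (y i) - chebyshevIntegral (fun x => f x * jacksonKernel h (y i) x)) ≤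
      4 / (h + 1 : ℝ) := by
    refine (sum_le_card_nsmul _ _ ((n : ℝ)⁻¹ * (4 / (h + 1 : ℝ))) fun i _ => ?_).trans_eq ?_
    · exact mul_le_mul_of_nonneg_left (sub_chebyshevIntegral_mul_jacksonKernel_le hh (hy i) hf)
        (by positivity)
    · simp
      field_simp
  rw [h3]
  have h5 : (0 : ℝ) ≤ 4 / (h + 1 : ℝ) := by positivity
  have h6 : 0 ≤ 2 * (((2 * h : ℕ) : ℝ) * η) := by positivity
  -- The denominator 1 + s ≥ 1 only helps, because the claimed bound is nonnegative.
  rw [div_le_iff₀ (by positivity)]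
  nlinarith

/-- The point x is transported to ±a with probabilities (1 ± x)/2. The cost is a - x² if |x| ≤ a and
|x| (1 - a) otherwise; both are at most 1 - a + a². -/
theorem sub_two_point_average_le {f : ℝ → ℝ} (hf : LipschitzWith 1 f) {x a : ℝ}
    (hx : x ∈ Set.Icc (-1 : ℝ) 1) (ha : a ∈ Set.Icc (0 : ℝ) 1) :
    f x - ((1 + x) / 2 * f a + (1 - x) / 2 * f (-a)) ≤ 1 - a + a ^ 2 := by
  obtain ⟨hx1, hx2⟩ := hx
  obtain ⟨ha1, ha2⟩ := ha
  have h1 := mul_le_mul_of_nonneg_left (hf.sub_le x a) (by linarith : 0 ≤ (1 + x) / 2)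
  have h2 := mul_le_mul_of_nonneg_left (hf.sub_le x (-a)) (by linarith : 0 ≤ (1 - x) / 2)
  rw [sub_neg_eq_add] at h2
  have h3 : f x - ((1 + x) / 2 * f a + (1 - x) / 2 * f (-a)) =
    (1 + x) / 2 * (f x - f a) + (1 - x) / 2 * (f x - f (-a)) := by ring
  rw [h3]
  refine (add_le_add h1 h2).trans ?_
  rcases abs_cases (x - a) with ⟨e1, c1⟩ | ⟨e1, c1⟩ <;>
    rcases abs_cases (x + a) with ⟨e2, c2⟩ | ⟨e2, c2⟩ <;> rw [e1, e2] <;>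
    nlinarith [sq_nonneg (1 - a), sq_nonneg x]

/-- Averaging the two-point transport over y gives the symmetric law on ±a up to an error |S|.
Taking a = |x| and integrating x against the Chebyshev weight reaches the Chebyshev distribution. A
constant below 1 is essential for the case of ε and δ near 1. -/
theorem average_sub_chebyshevIntegral_le (hn : 0 < n) {y : Fin n → ℝ}
    (hy : ∀ j, y j ∈ Set.Icc (-1 : ℝ) 1) {f : ℝ → ℝ} (hf : LipschitzWith 1 f) :
    (∑ i, f (y i)) / n - chebyshevIntegral f / Real.pi ≤ 15 / 16 + |(∑ i, y i) / n| := by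
  have hc := hf.continuous
  have hn' : (0 : ℝ) < n := by exact_mod_cast hn
  set F := (∑ i, f (y i)) / n with hF
  set S := (∑ i, y i) / n with hS
  have h1 : ∀ a ∈ Set.Icc (0 : ℝ) 1,
      F - (f a + f (-a)) / 2 ≤ 1 - a + a ^ 2 + |S| := by
    intro a ha
    have e : F - (f a + f (-a)) / 2 = (∑ i, (f (y i) - ((1 + y i) / 2 * f a +
        (1 - y i) / 2 * f (-a)))) / n + S * ((f a - f (-a)) / 2) := by
      have e1 : ∑ i, (f (y i) - ((1 + y i) / 2 * f a + (1 - y i) / 2 * f (-a))) =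
          (∑ i, f (y i)) - (n * ((f a + f (-a)) / 2) + (∑ i, y i) * ((f a - f (-a)) / 2)) := by
        rw [sum_sub_distrib, sum_mul]
        congr 1
        have e2 : (n : ℝ) * ((f a + f (-a)) / 2) = ∑ i : Fin n, (f a + f (-a)) / 2 := by simp
        rw [e2, ← sum_add_distrib]
        exact sum_congr rfl fun _ _ => by ring
      rw [e1, hF, hS]
      field_simp
      ring
    rw [e]
    have e2 : (∑ i, (f (y i) - ((1 + y i) / 2 * f a + (1 - y i) / 2 * f (-a)))) / n ≤
        1 - a + a ^ 2 := by
      rw [div_le_iff₀ hn']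
      refine (sum_le_card_nsmul _ _ _ fun i _ => sub_two_point_average_le hf (hy i) ha).trans_eq ?_
      simp
      ring
    have e3 : S * ((f a - f (-a)) / 2) ≤ |S| := by
      refine (le_abs_self _).trans ?_
      rw [abs_mul]
      refine mul_le_of_le_one_right (abs_nonneg _) ?_
      have := hf.abs_sub_le a (-a)
      rw [sub_neg_eq_add, abs_of_nonneg (by linarith [ha.1] : 0 ≤ a + a)] at this
      rw [abs_div, abs_two]
      linarith [ha.2]
    linarith
  have h2 : ∀ x ∈ Set.Icc (-1 : ℝ) 1,
      F - (1 + |S|) + (1 / 2) * (x ^ 2 * (1 - x ^ 2)) ≤ (f x + f (-x)) / 2 := by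
    intro x hx
    have hx1 : |x| ≤ 1 := abs_le.2 hx
    have h3 := h1 |x| ⟨abs_nonneg x, hx1⟩
    have h4 : f |x| + f (-|x|) = f x + f (-x) := by
      rcases abs_choice x with e | e <;> rw [e]
      rw [neg_neg, add_comm]
    rw [h4] at h3
    -- A polynomial lower bound for |x| - x² has an explicit integral: its mean is (1/2)(1/8) =
    -- 1/16, whence 15/16.
    have h5 : (1 / 2) * (x ^ 2 * (1 - x ^ 2)) ≤ |x| - |x| ^ 2 := by
      rw [← sq_abs x]
      have h0 := abs_nonneg x
      have : |x| - |x| ^ 2 - (1 / 2) * (|x| ^ 2 * (1 - |x| ^ 2)) =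
        |x| * (1 - |x|) * (2 - |x| * (1 + |x|)) / 2 := by ring
      have h6 : 0 ≤ 2 - |x| * (1 + |x|) := by nlinarith
      have h7 : 0 ≤ 1 - |x| := by linarith
      rw [← sub_nonneg, this]
      positivity
    linarith
  have h3 := chebyshevIntegral_mono (f := fun x => F - (1 + |S|) + (1 / 2) * (x ^ 2 * (1 - x ^ 2)))
    (g := fun x => (1 / 2) * (f x + f (-x))) (by fun_prop) (by fun_prop) fun x hx => by
      have := h2 x hx
      linarith
  have h4 : chebyshevIntegral (fun x => x ^ 2 * (1 - x ^ 2)) = Real.pi / 8 := by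
    have : ∀ θ : ℝ, Real.cos θ ^ 2 * (1 - Real.cos θ ^ 2) = Real.sin θ ^ 2 * Real.cos θ ^ 2 := by
      intro θ
      rw [Real.sin_sq]
      ring
    simp only [chebyshevIntegral, this]
    rw [integral_sin_sq_mul_cos_sq]
    have h4 : Real.sin (4 * Real.pi) = 0 := by exact_mod_cast Real.sin_nat_mul_pi 4
    simp [h4]
  rw [chebyshevIntegral_add (by fun_prop) (by fun_prop), chebyshevIntegral_const_mul,
    chebyshevIntegral_const_mul, chebyshevIntegral_add (by fun_prop) (by fun_prop),
    chebyshevIntegral_comp_neg, chebyshevIntegral_const, h4] at h3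
  have h5 : F - 15 / 16 - |S| ≤ chebyshevIntegral f / Real.pi := by
    rw [le_div_iff₀ Real.pi_pos]
    linarith
  linarith

/-- The independent coupling: |y - x| ≤ 1 - y x on [-1, 1], and the right side averages to an
expression in the two means. Smearing multiplies a mean by `jacksonRatio h 1`. -/
theorem sub_integral_dampedDensity_le_of_means (hn : 0 < n) {h : ℕ} (hh : 1 ≤ h) {s : ℝ}
    (hs : 0 ≤ s) {y m : Fin n → ℝ} (hy : ∀ j, y j ∈ Set.Icc (-1 : ℝ) 1) (hm : ∀ j, 0 ≤ m j)
    (hm1 : ∑ j, m j = 1) {f : ℝ → ℝ} (hf : LipschitzWith 1 f) :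
    (∑ i, f (y i)) / n - ∫ x in (-1 : ℝ)..1, f x * (dampedDensity h s y m x * chebyshevWeight x) ≤
      (1 - jacksonRatio h 1 * ((∑ i, y i) / n) * ∑ j, m j * y j +
        s * (15 / 16 + |(∑ i, y i) / n|)) / (1 + s) := by
  have hc := hf.continuous
  have hn' : (0 : ℝ) < n := by exact_mod_cast hn
  rw [sub_integral_mul_dampedDensity hn h hs y m hc]
  have h1 := average_sub_chebyshevIntegral_le hn hy hf
  refine div_le_div_of_nonneg_right (add_le_add ?_ (mul_le_mul_of_nonneg_left h1 hs)) (by positivity)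
  have h2 : ∀ i j, f (y i) - chebyshevIntegral (fun x => f x * jacksonKernel h (y j) x) ≤
      1 - jacksonRatio h 1 * y i * y j := by
    intro i j
    have h3 := chebyshevIntegral_mul_jacksonKernel_mono h (hy j) (f := fun x => f (y i) - f x)
      (g := fun x => 1 - y i * x) (by fun_prop) (by fun_prop) fun x hx => by
        refine (hf.sub_le _ _).trans (abs_le.2 ⟨?_, ?_⟩)
        · nlinarith [(hy i).1, (hy i).2, hx.1, hx.2]
        · nlinarith [(hy i).1, (hy i).2, hx.1, hx.2]
    simp_rw [sub_mul, mul_assoc] at h3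
    rw [chebyshevIntegral_sub (by fun_prop) (by fun_prop),
      chebyshevIntegral_sub (by fun_prop) (by fun_prop), chebyshevIntegral_const_mul,
      chebyshevIntegral_const_mul, chebyshevIntegral_const_mul,
      chebyshevIntegral_id_mul_jacksonKernel hh, chebyshevIntegral_jacksonKernel] at h3
    linarith
  have h4 : (∑ i, f (y i)) / n -
      ∑ j, m j * chebyshevIntegral (fun x => f x * jacksonKernel h (y j) x) =
      ∑ j, m j * ((∑ i, (f (y i) -
        chebyshevIntegral (fun x => f x * jacksonKernel h (y j) x))) / n) := by
    simp_rw [sum_sub_distrib, sub_div, mul_sub]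
    rw [sum_sub_distrib, ← sum_mul, hm1, one_mul]
    congr 1
    refine sum_congr rfl fun j _ => ?_
    rw [sum_const, card_univ, Fintype.card_fin, nsmul_eq_mul, mul_div_cancel_left₀ _ hn'.ne']
  have h5 : 1 - jacksonRatio h 1 * ((∑ i, y i) / n) * ∑ j, m j * y j =
      ∑ j, m j * ((∑ i, (1 - jacksonRatio h 1 * y i * y j)) / n) := by
    have e : ∀ j, (∑ i, (1 - jacksonRatio h 1 * y i * y j)) / n =
        1 - jacksonRatio h 1 * ((∑ i, y i) / n) * y j := by
      intro j
      rw [sum_sub_distrib, ← sum_mul, ← mul_sum]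
      simp
      field_simp
    simp_rw [e, mul_sub]
    rw [sum_sub_distrib, mul_sum]
    simp_rw [mul_one]
    rw [hm1]
    congr 1
    exact sum_congr rfl fun _ _ => by ring
  rw [h4, h5]
  exact sum_le_sum fun j _ => mul_le_mul_of_nonneg_left
    (div_le_div_of_nonneg_right (sum_le_sum fun i _ => h2 i j) hn'.le) (hm j)

end Transport

/-! ### The Hutchinson estimator as a random spectral measure -/

section Hutchinson

open Finset Polynomial.Chebyshev Matrix Prog

variable {𝕜 : Type} [RCLike 𝕜] {n ℓ : ℕ} {A : Matrix (Fin n) (Fin n) 𝕜} (hA : A.IsHermitian)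

/-- The mass at the `j`-th eigenvalue of the average spectral measure of the sign vectors. -/
noncomputable def hutchinsonMass (ω : Fin ℓ × Fin n → ℤˣ) (j : Fin n) : ℝ :=
  (∑ i, hA.componentSq (signVector 𝕜 ω i) j) / (ℓ * n)

theorem hutchinsonMass_nonneg (ω : Fin ℓ × Fin n → ℤˣ) (j : Fin n) : 0 ≤ hutchinsonMass hA ω j :=
  div_nonneg (sum_nonneg fun _ _ => hA.componentSq_nonneg _ _) (by positivity)

theorem signVector_eq (ω : Fin ℓ × Fin n → ℤˣ) (i : Fin ℓ) (a : Fin n) :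
    signVector 𝕜 ω i a = ((rsign (i, a) ω : ℝ) : 𝕜) := by
  simp [signVector, rsign]

theorem star_signVector (ω : Fin ℓ × Fin n → ℤˣ) (i : Fin ℓ) :
    star (signVector 𝕜 ω i) = signVector 𝕜 ω i := by
  funext a
  rw [Pi.star_apply, signVector_eq, RCLike.star_def, RCLike.conj_ofReal]

theorem sum_hutchinsonMass_mul_T (ω : Fin ℓ × Fin n → ℤˣ) (k : ℕ) :
    ((∑ j, hutchinsonMass hA ω j * (T ℝ k).eval (hA.eigenvalues j) : ℝ) : 𝕜) =
      (∑ i, signVector 𝕜 ω i ⬝ᵥ (Polynomial.aeval A (T 𝕜 k)) *ᵥ signVector 𝕜 ω i) /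
        ((ℓ : 𝕜) * (n : 𝕜)) := by
  have h1 : ∑ j, hutchinsonMass hA ω j * (T ℝ k).eval (hA.eigenvalues j) =
      (∑ i, ∑ j, hA.componentSq (signVector 𝕜 ω i) j * (T ℝ k).eval (hA.eigenvalues j)) /
        (ℓ * n) := by
    rw [sum_comm, sum_div]
    refine sum_congr rfl fun j _ => ?_
    rw [hutchinsonMass, ← sum_mul]
    ring
  have h2 : ∀ i, signVector 𝕜 ω i ⬝ᵥ (Polynomial.aeval A (T 𝕜 k)) *ᵥ signVector 𝕜 ω i =
      ((∑ j, hA.componentSq (signVector 𝕜 ω i) j * (T ℝ k).eval (hA.eigenvalues j) : ℝ) : 𝕜) := by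
    intro i
    rw [← hA.star_dotProduct_aeval_chebyshev_mulVec, star_signVector]
  rw [h1, RCLike.ofReal_div, RCLike.ofReal_sum, sum_congr rfl fun i _ => h2 i]
  simp

/-- This is the moment k = 0: a sign vector satisfies gᵀg = n exactly. -/
theorem sum_hutchinsonMass (hn : 0 < n) (hℓ : 0 < ℓ) (ω : Fin ℓ × Fin n → ℤˣ) :
    ∑ j, hutchinsonMass hA ω j = 1 := by
  apply RCLike.ofReal_injective (K := 𝕜)
  have h := sum_hutchinsonMass_mul_T hA ω 0
  have e : ∀ i, signVector 𝕜 ω i ⬝ᵥ signVector 𝕜 ω i = (n : 𝕜) := by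
    intro i
    rw [dotProduct]
    simp_rw [signVector_eq, ← RCLike.ofReal_mul, ← sq, rsign_sq]
    simp
  have hn' : (n : 𝕜) ≠ 0 := by exact_mod_cast hn.ne'
  have hℓ' : (ℓ : 𝕜) ≠ 0 := by exact_mod_cast hℓ.ne'
  simp only [Nat.cast_zero, T_zero, Polynomial.eval_one, mul_one, map_one, one_mulVec, e] at h
  rw [h]
  simp [hn', hℓ']

/-- The normalizations combine as √(2/π)/√(π/2) = 2/π, and the shift equals s/π with s = √(2π)/N.
Hence the scale 1 + s is exactly the total mass. -/
theorem density_run_kpm (hn : 0 < n) (hℓ : 0 < ℓ) {h : ℕ} (hh : 1 ≤ h)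
    (ω : Fin ℓ × Fin n → ℤˣ) :
    ((Prog.kpm (2 * h) (Prog.hutchinson (2 * h) ℓ)).run A ω).value.density = fun x =>
      dampedDensity h (Real.sqrt (2 * Real.pi) / (2 * h : ℕ)) hA.eigenvalues
        (hutchinsonMass hA ω) x * chebyshevWeight x := by
  funext x
  have hπ := Real.pi_pos
  have h0 : jacksonCoeff h 0 / jacksonCoeff h 0 = 1 := div_self (jacksonCoeff_zero_pos h).ne'
  have key : ∀ k : Fin (2 * h), RCLike.re (((Prog.hutchinson (2 * h) ℓ).run A ω).value k) =
      Real.sqrt (2 / Real.pi) * ∑ j, hutchinsonMass hA ω j *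
        (T ℝ ((k : ℕ) + 1 : ℕ)).eval (hA.eigenvalues j) := by
    intro k
    rw [run_hutchinson_value, div_mul_eq_mul_div, mul_div_assoc, ← sum_hutchinsonMass_mul_T hA,
      RCLike.re_ofReal_mul, RCLike.ofReal_re]
  have hs : Real.sqrt (2 / Real.pi) / Real.sqrt (Real.pi / 2) = 2 / Real.pi := by
    rw [← Real.sqrt_div (by positivity), show 2 / Real.pi / (Real.pi / 2) = (2 / Real.pi) ^ 2 by
      field_simp, Real.sqrt_sq (by positivity)]
  have hp : (1 / Real.sqrt Real.pi) * (1 / Real.sqrt Real.pi) = 1 / Real.pi := by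
    rw [div_mul_div_comm, Real.mul_self_sqrt hπ.le, one_mul]
  have hshift : Real.sqrt 2 / ((2 * h : ℕ) * Real.sqrt Real.pi) =
      Real.sqrt (2 * Real.pi) / (2 * h : ℕ) / Real.pi := by
    have : (0 : ℝ) < (2 * h : ℕ) := by exact_mod_cast (by omega : 0 < 2 * h)
    rw [Real.sqrt_mul zero_le_two, div_div, div_eq_div_iff (by positivity) (by positivity)]
    nth_rewrite 1 [← Real.mul_self_sqrt hπ.le]
    ring
  simp only [KPMOutput.density, run_kpm_value, Fin.sum_univ_succ, Fin.cons_zero, Fin.cons_succ,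
    RCLike.re_ofReal_mul, RCLike.ofReal_re, key, Fin.val_zero, h0, normalizedChebyshev,
    Fin.val_succ, Nat.cast_zero, T_zero, Polynomial.eval_one, if_true, Nat.succ_ne_zero, if_false,
    one_mul, hp, hshift, dampedDensity]
  have e1 : ∀ k : Fin (2 * h), jacksonCoeff h ((k : ℕ) + 1) / jacksonCoeff h 0 *
      (Real.sqrt (2 / Real.pi) * ∑ j, hutchinsonMass hA ω j *
        (T ℝ ((k : ℕ) + 1 : ℕ)).eval (hA.eigenvalues j)) *
      ((T ℝ ((k : ℕ) + 1 : ℕ)).eval x / Real.sqrt (Real.pi / 2)) =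
      2 / Real.pi * ∑ j, hutchinsonMass hA ω j * (jacksonRatio h ((k : ℕ) + 1) *
        (T ℝ ((k : ℕ) + 1 : ℕ)).eval (hA.eigenvalues j) * (T ℝ ((k : ℕ) + 1 : ℕ)).eval x) := by
    intro k
    have : ∑ j, hutchinsonMass hA ω j * (jacksonRatio h ((k : ℕ) + 1) *
        (T ℝ ((k : ℕ) + 1 : ℕ)).eval (hA.eigenvalues j) * (T ℝ ((k : ℕ) + 1 : ℕ)).eval x) =
        jacksonRatio h ((k : ℕ) + 1) * (T ℝ ((k : ℕ) + 1 : ℕ)).eval x *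
          ∑ j, hutchinsonMass hA ω j * (T ℝ ((k : ℕ) + 1 : ℕ)).eval (hA.eigenvalues j) := by
      rw [mul_sum]
      exact sum_congr rfl fun _ _ => by ring
    rw [this, jacksonRatio]
    linear_combination (jacksonCoeff h ((k : ℕ) + 1) / jacksonCoeff h 0 *
      (T ℝ ((k : ℕ) + 1 : ℕ)).eval x *
        ∑ j, hutchinsonMass hA ω j * (T ℝ ((k : ℕ) + 1 : ℕ)).eval (hA.eigenvalues j)) * hs
  rw [sum_congr rfl fun k _ => e1 k, ← mul_sum, sum_comm]
  have e2 : ∑ j, hutchinsonMass hA ω j * jacksonKernel h (hA.eigenvalues j) x =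
      1 / Real.pi + 2 / Real.pi * ∑ j, ∑ k : Fin (2 * h), hutchinsonMass hA ω j *
        (jacksonRatio h ((k : ℕ) + 1) * (T ℝ ((k : ℕ) + 1 : ℕ)).eval (hA.eigenvalues j) *
          (T ℝ ((k : ℕ) + 1 : ℕ)).eval x) := by
    have : 1 / Real.pi = ∑ j, hutchinsonMass hA ω j / Real.pi := by
      rw [← sum_div, sum_hutchinsonMass hA hn hℓ ω]
    rw [this, mul_sum, ← sum_add_distrib]
    refine sum_congr rfl fun j _ => ?_
    rw [jacksonKernel, sum_range, ← mul_sum]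
    ring
  rw [e2]
  ring

/-- The off-diagonal part of the real part of `T_k(A)`, repeated for each repetition. -/
noncomputable def hutchinsonForm (A : Matrix (Fin n) (Fin n) 𝕜) (ℓ k : ℕ) (p q : Fin ℓ × Fin n) : ℝ :=
  if p.1 = q.1 ∧ p.2 ≠ q.2 then RCLike.re ((Polynomial.aeval A (T 𝕜 k)) p.2 q.2) else 0

/-- Squared signs are 1, so the diagonal contributes the trace without randomness. As the signs are
real, the real parts of the entries suffice. -/
theorem sum_hutchinsonForm (k : ℕ) (ω : Fin ℓ × Fin n → ℤˣ) :
    ∑ p, ∑ q, hutchinsonForm A ℓ k p q * (rsign p ω * rsign q ω) =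
      RCLike.re (∑ i, signVector 𝕜 ω i ⬝ᵥ (Polynomial.aeval A (T 𝕜 k)) *ᵥ signVector 𝕜 ω i) -
        ℓ * RCLike.re (Polynomial.aeval A (T 𝕜 k)).trace := by
  set B := Polynomial.aeval A (T 𝕜 k) with hB
  have h1 : ∀ i : Fin ℓ, RCLike.re (signVector 𝕜 ω i ⬝ᵥ B *ᵥ signVector 𝕜 ω i) =
      ∑ a, ∑ b, RCLike.re (B a b) * (rsign (i, a) ω * rsign (i, b) ω) := by
    intro i
    simp only [dotProduct, mulVec, mul_sum, map_sum]
    refine sum_congr rfl fun a _ => sum_congr rfl fun b _ => ?_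
    rw [signVector_eq, signVector_eq, RCLike.re_ofReal_mul, RCLike.re_mul_ofReal]
    ring
  have h2 : ∀ p : Fin ℓ × Fin n, ∑ q, hutchinsonForm A ℓ k p q * (rsign p ω * rsign q ω) =
      ∑ b, RCLike.re (B p.2 b) * (rsign (p.1, p.2) ω * rsign (p.1, b) ω) - RCLike.re (B p.2 p.2) := by
    intro p
    have h3 : ∀ q : Fin ℓ × Fin n, hutchinsonForm A ℓ k p q * (rsign p ω * rsign q ω) =
        if q.1 = p.1 then (RCLike.re (B p.2 q.2) * (rsign (p.1, p.2) ω * rsign (p.1, q.2) ω) -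
          if q.2 = p.2 then RCLike.re (B p.2 p.2) else 0) else 0 := by
      rintro ⟨i, b⟩
      obtain ⟨i', a⟩ := p
      simp only [hutchinsonForm]
      by_cases hi : i = i'
      · subst hi
        by_cases hab : b = a
        · subst hab
          simp only [ne_eq, not_true_eq_false, and_false, if_false, zero_mul, if_true, ← sq, rsign_sq]
          ring
        · simp [Ne.symm hab, hab, hB]
      · simp [hi, Ne.symm hi]
    simp_rw [h3]
    rw [Fintype.sum_prod_type]
    rw [sum_eq_single p.1 (fun i _ hi => by simp [hi]) (by simp)]
    simp [sum_sub_distrib]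
  simp_rw [h2]
  rw [Fintype.sum_prod_type]
  simp only [sum_sub_distrib, map_sum, h1, trace, diag_apply]
  simp

theorem hutchinsonForm_self (k : ℕ) (p : Fin ℓ × Fin n) : hutchinsonForm A ℓ k p p = 0 := by
  simp [hutchinsonForm]

theorem sum_hutchinsonForm_sq_le (hspec : ∀ j, |hA.eigenvalues j| ≤ 1) (k : ℕ) :
    ∑ p, ∑ q, hutchinsonForm A ℓ k p q ^ 2 ≤ ℓ * n := by
  set B := Polynomial.aeval A (T 𝕜 k) with hB
  have h1 : ∀ p : Fin ℓ × Fin n, ∑ q, hutchinsonForm A ℓ k p q ^ 2 ≤ ∑ b, ‖B p.2 b‖ ^ 2 := by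
    intro p
    have h3 : ∀ q : Fin ℓ × Fin n, hutchinsonForm A ℓ k p q ^ 2 ≤
        if q.1 = p.1 then ‖B p.2 q.2‖ ^ 2 else 0 := by
      rintro ⟨i, b⟩
      obtain ⟨i', a⟩ := p
      simp only [hutchinsonForm]
      by_cases hi : i = i'
      · subst hi
        by_cases hab : b = a
        · subst hab; simp
        · simp only [ne_eq, Ne.symm hab, not_false_eq_true, and_self, if_true]
          rw [← sq_abs]
          exact pow_le_pow_left₀ (abs_nonneg _) (RCLike.abs_re_le_norm _) 2
      · simp [hi, Ne.symm hi]
    refine (sum_le_sum fun q _ => h3 q).trans ?_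
    rw [Fintype.sum_prod_type, sum_eq_single p.1 (fun i _ hi => by simp [hi]) (by simp)]
    simp
  refine (sum_le_sum fun p _ => h1 p).trans ?_
  rw [Fintype.sum_prod_type]
  simp only [hB, hA.sum_norm_sq_aeval_chebyshev]
  have h4 : ∑ j, (T ℝ k).eval (hA.eigenvalues j) ^ 2 ≤ n := by
    refine (sum_le_card_nsmul _ _ 1 fun j _ => ?_).trans_eq (by simp)
    exact (sq_le_one_iff_abs_le_one _).2 (abs_eval_T_real_le_one _ (hspec j))
  rw [sum_const, card_univ, Fintype.card_fin, nsmul_eq_mul]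
  gcongr

theorem sum_sub_hutchinsonMass_mul_T (hn : 0 < n) (hℓ : 0 < ℓ) (k : ℕ) (ω : Fin ℓ × Fin n → ℤˣ) :
    ∑ j, ((n : ℝ)⁻¹ - hutchinsonMass hA ω j) * (T ℝ k).eval (hA.eigenvalues j) =
      -(∑ p, ∑ q, hutchinsonForm A ℓ k p q * (rsign p ω * rsign q ω)) / (ℓ * n) := by
  have h1 := congrArg RCLike.re (sum_hutchinsonMass_mul_T hA ω k)
  have e : ((ℓ : 𝕜) * (n : 𝕜)) = ((ℓ * n : ℝ) : 𝕜) := by push_cast; rfl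
  have h2 := congrArg RCLike.re (hA.trace_aeval_chebyshev k)
  rw [RCLike.ofReal_re] at h1 h2
  rw [e, div_eq_inv_mul, ← RCLike.ofReal_inv, RCLike.re_ofReal_mul] at h1
  rw [sum_hutchinsonForm, h2]
  simp_rw [sub_mul]
  rw [sum_sub_distrib, h1, ← mul_sum]
  have hn' : (n : ℝ) ≠ 0 := by exact_mod_cast hn.ne'
  have hℓ' : (ℓ : ℝ) ≠ 0 := by exact_mod_cast hℓ.ne'
  field_simp
  ring

/-- Products of two distinct signs have mean 0, so the off-diagonal error has mean 0. -/
theorem signMean_sum_hutchinsonMass_mul_eigenvalues (hn : 0 < n) (hℓ : 0 < ℓ) :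
    signMean (fun ω : Fin ℓ × Fin n → ℤˣ => ∑ j, hutchinsonMass hA ω j * hA.eigenvalues j) =
      (∑ j, hA.eigenvalues j) / n := by
  have h1 : (fun ω : Fin ℓ × Fin n → ℤˣ => ∑ j, hutchinsonMass hA ω j * hA.eigenvalues j) =
      fun ω => (∑ j, hA.eigenvalues j) / n + (1 / (ℓ * n : ℝ)) *
        ∑ p, ∑ q, hutchinsonForm A ℓ 1 p q * (rsign p ω * rsign q ω) := by
    funext ω
    have := sum_sub_hutchinsonMass_mul_T hA hn hℓ 1 ω
    simp only [Nat.cast_one, T_one, Polynomial.eval_X, sub_mul, sum_sub_distrib, ← mul_sum] at this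
    linear_combination -this
  rw [h1, signMean_add, signMean_const, signMean_const_mul, signMean_sum]
  simp_rw [signMean_sum, signMean_const_mul]
  have h2 : ∑ p : Fin ℓ × Fin n, ∑ q, hutchinsonForm A ℓ 1 p q *
      signMean (fun ω => rsign p ω * rsign q ω) = 0 := by
    refine sum_eq_zero fun p _ => sum_eq_zero fun q _ => ?_
    by_cases hpq : p = q
    · rw [hpq, hutchinsonForm_self, zero_mul]
    · rw [signMean_rsign_mul_rsign hpq, mul_zero]
  rw [h2, mul_zero, add_zero]

/-- The tail bound at t = η ℓ n, with variance proxy V = 2 ℓ n from the Frobenius norm. -/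
theorem signProb_moment_error_le (hn : 0 < n) (hℓ : 0 < ℓ) (hspec : ∀ j, |hA.eigenvalues j| ≤ 1)
    (k : ℕ) {r η : ℝ} (hr : 1 ≤ r) (hη : 0 < η)
    (hrη : 2 * (2 * Real.exp 1 * r) ^ 2 ≤ η ^ 2 * (ℓ * n)) :
    signProb {ω : Fin ℓ × Fin n → ℤˣ |
      η ≤ |∑ j, ((n : ℝ)⁻¹ - hutchinsonMass hA ω j) * (T ℝ k).eval (hA.eigenvalues j)|} ≤
        Real.exp (-r) := by
  have hn' : (0 : ℝ) < n := by exact_mod_cast hn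
  have hℓ' : (0 : ℝ) < ℓ := by exact_mod_cast hℓ
  have h1 := (chaosBound_quadratic (hutchinsonForm A ℓ k) (hutchinsonForm_self k) univ).mono
    (mul_nonneg zero_le_two (sum_nonneg fun _ _ => sum_nonneg fun _ _ => sq_nonneg _))
    (mul_le_mul_of_nonneg_left (sum_hutchinsonForm_sq_le (ℓ := ℓ) hA hspec k) zero_le_two)
  refine (signProb_mono fun ω hω => ?_).trans
    (h1.tail (t := η * (ℓ * n)) hr (by positivity) (by positivity) ?_)
  · rw [Set.mem_ofPred_eq, sum_sub_hutchinsonMass_mul_T hA hn hℓ, neg_div, abs_neg, abs_div,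
      abs_of_pos (by positivity : (0 : ℝ) < ℓ * n), le_div_iff₀ (by positivity)] at hω
    exact hω
  · calc (2 * Real.exp 1 * r) ^ 2 * (2 * (ℓ * n)) = 2 * (2 * Real.exp 1 * r) ^ 2 * (ℓ * n) := by ring
      _ ≤ η ^ 2 * (ℓ * n) * (ℓ * n) := by gcongr
      _ = _ := by ring

end Hutchinson

/-! ### Positivity, cost and accuracy of the algorithm -/

section Guarantees

open Finset Polynomial.Chebyshev Prog

variable {𝕜 : Type} [RCLike 𝕜] {n ℓ : ℕ} {A : Matrix (Fin n) (Fin n) 𝕜} (hA : A.IsHermitian)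

theorem isProbabilityDensity_run_kpm (hspec : ∀ j, |hA.eigenvalues j| ≤ 1) (hn : 0 < n)
    (hℓ : 0 < ℓ) {h : ℕ} (hh : 1 ≤ h) (ω : Fin ℓ × Fin n → ℤˣ) :
    IsProbabilityDensity
      ((Prog.kpm (2 * h) (Prog.hutchinson (2 * h) ℓ)).run A ω).value.density := by
  rw [density_run_kpm hA hn hℓ hh ω]
  exact isProbabilityDensity_dampedDensity h (by positivity) (fun j => abs_le.1 (hspec j))
    (hutchinsonMass_nonneg hA ω) (sum_hutchinsonMass hA hn hℓ ω)

theorem run_kpm_hutchinson_steps_le {N : ℕ} (hn : 1 ≤ n) (hN : 1 ≤ N) (hℓ : 1 ≤ ℓ)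
    (ω : Fin ℓ × Fin n → ℤˣ) :
    (((Prog.kpm N (Prog.hutchinson N ℓ)).run A ω).steps : ℝ) ≤
      30 * (n * N * ℓ) + 100 * (N : ℝ) ^ 2 := by
  have := (run_kpm_steps_le A ω hN (Prog.hutchinson N ℓ)).trans
    (Nat.add_le_add_right (run_hutchinson_steps_le A hn hN hℓ ω) _)
  exact_mod_cast this

theorem sqrt_two_pi_mem_Icc : Real.sqrt (2 * Real.pi) ∈ Set.Icc (2 : ℝ) 3 := by
  refine ⟨Real.le_sqrt_of_sq_le ?_, Real.sqrt_le_iff.2 ⟨by norm_num, ?_⟩⟩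
  · nlinarith [Real.pi_gt_three]
  · nlinarith [Real.pi_lt_four]

theorem wasserstein1_run_kpm_le_of_moments (hspec : ∀ j, |hA.eigenvalues j| ≤ 1) (hn : 0 < n)
    (hℓ : 0 < ℓ) {h : ℕ} (hh : 1 ≤ h) (ω : Fin ℓ × Fin n → ℤˣ) {η : ℝ}
    (hη : ∀ k < 2 * h, |∑ j, ((n : ℝ)⁻¹ - hutchinsonMass hA ω j) *
      (T ℝ (k + 1 : ℕ)).eval (hA.eigenvalues j)| ≤ η) :
    wasserstein1 (spectralDensity hA)
      ((Prog.kpm (2 * h) (Prog.hutchinson (2 * h) ℓ)).run A ω).value.density ≤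
        ENNReal.ofReal (14 / (2 * h : ℕ) + 2 * ((2 * h : ℕ) * η)) := by
  rw [density_run_kpm hA hn hℓ hh ω]
  refine wasserstein1_le hA fun f hf => ?_
  refine (sub_integral_dampedDensity_le_of_moments hn hh (by positivity)
    (fun j => abs_le.1 (hspec j)) (sum_hutchinsonMass hA hn hℓ ω) hη hf).trans ?_
  have hpos : (0 : ℝ) < h := by exact_mod_cast hh
  have h1 : 4 / (h + 1 : ℝ) ≤ 8 / (2 * h : ℕ) := by
    push_cast
    rw [div_le_div_iff₀ (by positivity) (by positivity)]
    linarith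
  have h2 : Real.sqrt (2 * Real.pi) / (2 * h : ℕ) ≤ 3 / (2 * h : ℕ) := by
    gcongr
    exact sqrt_two_pi_mem_Icc.2
  -- With N = 2h, smearing costs at most 8/N and mixing at most 2 · 3/N.
  have h3 : (14 : ℝ) / (2 * h : ℕ) = 8 / (2 * h : ℕ) + 2 * (3 / (2 * h : ℕ)) := by ring
  linarith

/-- With many random signs, the moments are accurate with high probability. -/
theorem signProb_wasserstein1_gt_le (hspec : ∀ j, |hA.eigenvalues j| ≤ 1) (hn : 0 < n)
    (hℓ : 0 < ℓ) {h : ℕ} (hh : 1 ≤ h) {ε r η : ℝ} (hr : 1 ≤ r) (hη : 0 < η)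
    (hrη : 2 * (2 * Real.exp 1 * r) ^ 2 ≤ η ^ 2 * (ℓ * n))
    (hε : 14 / (2 * h : ℕ) + 2 * ((2 * h : ℕ) * η) ≤ ε) :
    signProb {ω : Fin ℓ × Fin n → ℤˣ | wasserstein1 (spectralDensity hA)
      ((Prog.kpm (2 * h) (Prog.hutchinson (2 * h) ℓ)).run A ω).value.density ≤
        ENNReal.ofReal ε}ᶜ ≤ (2 * h : ℕ) * Real.exp (-r) := by
  have hsub : {ω : Fin ℓ × Fin n → ℤˣ | wasserstein1 (spectralDensity hA)
      ((Prog.kpm (2 * h) (Prog.hutchinson (2 * h) ℓ)).run A ω).value.density ≤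
        ENNReal.ofReal ε}ᶜ ⊆ ⋃ k ∈ range (2 * h), {ω | η ≤ |∑ j, ((n : ℝ)⁻¹ -
          hutchinsonMass hA ω j) * (T ℝ (k + 1 : ℕ)).eval (hA.eigenvalues j)|} := by
    intro ω hω
    by_contra hcon
    simp only [Set.mem_iUnion, Set.mem_ofPred_eq, not_exists, not_le] at hcon
    exact hω ((wasserstein1_run_kpm_le_of_moments hA hspec hn hℓ hh ω fun k hk =>
      (hcon k (mem_range.2 hk)).le).trans (ENNReal.ofReal_le_ofReal hε))
  refine (signProb_mono hsub).trans ((signProb_iUnion_le _ _).trans ?_)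
  refine (sum_le_card_nsmul _ _ _ fun k _ =>
    signProb_moment_error_le hA hn hℓ hspec (k + 1) hr hη hrη).trans_eq ?_
  simp

/-- For every number of random signs, the distance is below `1` with positive probability. -/
theorem mul_signProb_wasserstein1_gt_le (hspec : ∀ j, |hA.eigenvalues j| ≤ 1) (hn : 0 < n)
    (hℓ : 0 < ℓ) {h : ℕ} (hh : 40 ≤ h) (hh' : h ≤ 84) (ε : ℝ) :
    ε * signProb {ω : Fin ℓ × Fin n → ℤˣ | wasserstein1 (spectralDensity hA)
      ((Prog.kpm (2 * h) (Prog.hutchinson (2 * h) ℓ)).run A ω).value.density ≤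
        ENNReal.ofReal ε}ᶜ ≤ 1 - 1 / 3840 := by
  have hn' : (0 : ℝ) < n := by exact_mod_cast hn
  have hh1 : 1 ≤ h := by omega
  have hhr : (40 : ℝ) ≤ h := by exact_mod_cast hh
  have hhr' : (h : ℝ) ≤ 84 := by exact_mod_cast hh'
  set s : ℝ := Real.sqrt (2 * Real.pi) / (2 * h : ℕ) with hs
  set ρ : ℝ := jacksonRatio h 1 with hρ
  set S : ℝ := (∑ i, hA.eigenvalues i) / n with hS
  have hs1 : 1 / 84 ≤ s := by
    rw [hs, div_le_div_iff₀ (by norm_num) (by push_cast; linarith)]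
    push_cast
    linarith [sqrt_two_pi_mem_Icc.1]
  have hs2 : s ≤ 3 / 80 := by
    rw [hs, div_le_div_iff₀ (by push_cast; linarith) (by norm_num)]
    push_cast
    linarith [sqrt_two_pi_mem_Icc.2]
  have hρ1 : ρ ≤ 1 := (abs_le.1 (abs_jacksonRatio_le_one (h := h) (k := 0) (by omega))).2
  have hρ2 : 1 / 2 ≤ ρ := by
    have h1 := one_sub_jacksonRatio_one_le h
    have h2 : 3 / (h + 1 : ℝ) ^ 2 ≤ 1 / 2 := by
      rw [div_le_div_iff₀ (by positivity) (by norm_num)]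
      nlinarith
    linarith
  -- The bound from the two means, used as a nonnegative majorant of W₁ in Markov's inequality.
  set B : (Fin ℓ × Fin n → ℤˣ) → ℝ := fun ω =>
    (1 - ρ * S * ∑ j, hutchinsonMass hA ω j * hA.eigenvalues j + s * (15 / 16 + |S|)) / (1 + s)
    with hB
  have hS1 : |S| ≤ 1 := by
    rw [hS, abs_div, abs_of_pos hn', div_le_one hn']
    refine (abs_sum_le_sum_abs _ _).trans ?_
    refine (sum_le_card_nsmul _ _ 1 fun i _ => hspec i).trans_eq (by simp)
  have hB0 : ∀ ω, 0 ≤ B ω := by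
    intro ω
    have hM : |∑ j, hutchinsonMass hA ω j * hA.eigenvalues j| ≤ 1 := by
      refine (abs_sum_le_sum_abs _ _).trans ?_
      rw [← sum_hutchinsonMass hA hn hℓ ω]
      refine sum_le_sum fun j _ => ?_
      rw [abs_mul, abs_of_nonneg (hutchinsonMass_nonneg hA ω j)]
      exact mul_le_of_le_one_right (hutchinsonMass_nonneg hA ω j) (hspec j)
    have h1 : ρ * S * ∑ j, hutchinsonMass hA ω j * hA.eigenvalues j ≤ 1 := by
      refine (le_abs_self _).trans ?_
      rw [abs_mul, abs_mul, abs_of_nonneg (by linarith : 0 ≤ ρ)]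
      exact mul_le_one₀ (mul_le_one₀ hρ1 (abs_nonneg _) hS1) (abs_nonneg _) hM
    have h2 : 0 ≤ s * (15 / 16 + |S|) := mul_nonneg (by linarith) (by positivity)
    exact div_nonneg (by linarith) (by linarith)
  have hsub : {ω : Fin ℓ × Fin n → ℤˣ | wasserstein1 (spectralDensity hA)
      ((Prog.kpm (2 * h) (Prog.hutchinson (2 * h) ℓ)).run A ω).value.density ≤
        ENNReal.ofReal ε}ᶜ ⊆ {ω | ε ≤ B ω} := by
    intro ω hω
    by_contra hcon
    refine hω ((wasserstein1_le hA (B := B ω) fun f hf => ?_).trans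
      (ENNReal.ofReal_le_ofReal (not_le.1 hcon).le))
    rw [density_run_kpm hA hn hℓ hh1 ω]
    exact sub_integral_dampedDensity_le_of_means hn hh1 (by linarith)
      (fun j => abs_le.1 (hspec j)) (hutchinsonMass_nonneg hA ω) (sum_hutchinsonMass hA hn hℓ ω) hf
  have hmean : signMean B = (1 - ρ * S * S + s * (15 / 16 + |S|)) / (1 + s) := by
    have e : B = fun ω => (1 + s * (15 / 16 + |S|)) / (1 + s) + (-(ρ * S) / (1 + s)) *
        ∑ j, hutchinsonMass hA ω j * hA.eigenvalues j := by
      funext ω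
      rw [hB]
      ring
    rw [e, signMean_add, signMean_const, signMean_const_mul,
      signMean_sum_hutchinsonMass_mul_eigenvalues hA hn hℓ]
    ring
  -- Since ρ ≥ 1/2, s|S| - ρS² ≤ s²/2. What remains is s/16 - s²/2 ≥ (1 + s)/3840, valid for 1/84 ≤
  -- s ≤ 3/80.
  have hfinal : signMean B ≤ 1 - 1 / 3840 := by
    rw [hmean, div_le_iff₀ (by linarith), mul_assoc, ← abs_mul_abs_self S]
    nlinarith [mul_nonneg (sub_nonneg.2 hρ2) (mul_self_nonneg |S|), sq_nonneg (|S| - s),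
      mul_nonneg (sub_nonneg.2 hs1) (sub_nonneg.2 hs2)]
  rcases le_or_gt ε 0 with h0 | h0
  · have : 0 ≤ signProb {ω : Fin ℓ × Fin n → ℤˣ | wasserstein1 (spectralDensity hA)
      ((Prog.kpm (2 * h) (Prog.hutchinson (2 * h) ℓ)).run A ω).value.density ≤
        ENNReal.ofReal ε}ᶜ :=
      signMean_nonneg fun ω => Set.indicator_nonneg (fun _ _ => zero_le_one) ω
    nlinarith
  · calc _ ≤ ε * signProb {ω | ε ≤ B ω} := mul_le_mul_of_nonneg_left (signProb_mono hsub) h0.le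
      _ ≤ signMean B := mul_signProb_le hB0 ε
      _ ≤ _ := hfinal

end Guarantees

/-! ### Numerical consequences of the choice of parameters -/

section Parameters

theorem degree_mem_Icc {ε : ℝ} (hε : ε ∈ Set.Ioo (0 : ℝ) 1) :
    ((4 * ⌈20 / ε⌉₊ : ℕ) : ℝ) ∈ Set.Icc (80 / ε) (84 / ε) := by
  obtain ⟨h0, h1⟩ := hε
  have h2 := Nat.le_ceil (20 / ε)
  have h3 := Nat.ceil_lt_add_one (by positivity : 0 ≤ 20 / ε)
  have h4 : 1 ≤ 1 / ε := by rw [le_div_iff₀ h0]; linarith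
  have e1 : 80 / ε = 4 * (20 / ε) := by ring
  have e2 : 84 / ε = 4 * (20 / ε) + 4 * (1 / ε) := by ring
  push_cast
  rw [e1, e2]
  constructor <;> linarith

theorem log_inv_mul_ge {ε δ κ : ℝ} (hε : ε ∈ Set.Ioo (0 : ℝ) 1) (hδ : δ ∈ Set.Ioo (0 : ℝ) 1)
    (h : ε ≤ 1 - κ ∨ δ ≤ 1 - κ) : κ ≤ Real.log (1 / (ε * δ)) := by
  obtain ⟨h0, h1⟩ := hε
  obtain ⟨h2, h3⟩ := hδ
  have hpos : 0 < ε * δ := by positivity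
  rw [one_div, Real.log_inv]
  have h4 := Real.log_le_sub_one_of_pos hpos
  have h5 : ε * δ ≤ 1 - κ := by rcases h with h | h <;> nlinarith
  linarith

/-- Absorbs the N² steps spent on Jackson coefficients into nL/ε. For ε ≤ 1/2 the logarithm is at
least 1/2 and the factor ε⁻⁴ in L suffices; for ε > 1/2 the bound nL ≥ 1 does. -/
theorem one_div_le_two_mul {ε δ L K : ℝ} {n : ℕ} (hn : 0 < n) (hε : ε ∈ Set.Ioo (0 : ℝ) 1)
    (hδ : δ ∈ Set.Ioo (0 : ℝ) 1) (hK : 4 ≤ K) (hL1 : 1 ≤ L)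
    (hL : K * (1 / ε ^ 4) * Real.log (1 / (ε * δ)) ^ 2 ≤ n * L) : 1 / ε ≤ 2 * (n * L) := by
  have hn' : (1 : ℝ) ≤ n := by exact_mod_cast hn
  have h0 := hε.1
  rcases le_or_gt ε (1 - 1 / 2) with h | h
  · have h1 := log_inv_mul_ge hε hδ (Or.inl h)
    have h2 : (1 / 4 : ℝ) ≤ Real.log (1 / (ε * δ)) ^ 2 := by nlinarith
    have h3 : 1 / ε ≤ 1 / ε ^ 4 := by
      refine one_div_le_one_div_of_le (by positivity) ?_
      simpa using pow_le_pow_of_le_one h0.le hε.2.le (show 1 ≤ 4 by norm_num)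
    have h4 : 0 ≤ 1 / ε ^ 4 := by positivity
    calc 1 / ε ≤ 4 * (1 / ε ^ 4) * (1 / 4) := by linarith
      _ ≤ K * (1 / ε ^ 4) * Real.log (1 / (ε * δ)) ^ 2 := by gcongr
      _ ≤ n * L := hL
      _ ≤ 2 * (n * L) := by nlinarith
  · have : 1 / ε ≤ 2 := by rw [div_le_iff₀ h0]; linarith
    nlinarith

end Parameters

/-! ### Choice of constants and assembly -/

theorem theorem1 :
    ∃ C₀ C C' C'' : ℝ, 0 < C₀ ∧ 0 < C ∧ 0 < C' ∧ 0 < C'' ∧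
      ∀ (𝕜 : Type) [RCLike 𝕜] (n : ℕ) (_ : 0 < n) (A : Matrix (Fin n) (Fin n) 𝕜)
        (hA : A.IsHermitian) (_ : ‖Matrix.toEuclideanCLM (𝕜 := 𝕜) A‖ ≤ 1)
        (ε δ : ℝ) (_ : ε ∈ Set.Ioo (0 : ℝ) 1) (_ : δ ∈ Set.Ioo (0 : ℝ) 1) (L : ℝ) (ℓ N : ℕ)
        (_ : L = max 1 (C' / n * (1 / ε ^ 4) * Real.log (1 / (ε * δ)) ^ 2))
        (_ : ℓ = ⌈L⌉₊) (_ : N = 4 * ⌈C₀ / ε⌉₊),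
        (∀ ω : Fin ℓ × Fin n → ℤˣ,
          ((Prog.kpm N (Prog.hutchinson N ℓ)).run A ω).matvecs = N * ℓ ∧
          (N * ℓ : ℝ) ≤ C * L / ε ∧
          (((Prog.kpm N (Prog.hutchinson N ℓ)).run A ω).steps : ℝ) ≤ C'' * (n * L / ε) ∧
          IsProbabilityDensity ((Prog.kpm N (Prog.hutchinson N ℓ)).run A ω).value.density) ∧
        ENNReal.ofReal (1 - δ) ≤
          (PMF.uniformOfFintype (Fin ℓ × Fin n → ℤˣ)).toOuterMeasure
            {ω | wasserstein1 (spectralDensity hA)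
              ((Prog.kpm N (Prog.hutchinson N ℓ)).run A ω).value.density ≤ ENNReal.ofReal ε} := by
  -- The threshold between the two regimes: (1 - κ)² > 1 - 2κ = 1 - 1/3840.
  set κ : ℝ := 1 / 7680 with hκ
  -- Chosen so that Λ ≥ κ implies log 84 + Λ ≤ R Λ.
  set R : ℝ := Real.log 84 / κ + 1 with hR
  have hlog : 1 ≤ Real.log 84 := by
    rw [Real.le_log_iff_exp_le (by norm_num)]
    linarith [Real.exp_one_lt_d9]
  have hR1 : 1 ≤ R := by
    have : 0 ≤ Real.log 84 / κ := by positivity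
    linarith
  have he : 1 ≤ Real.exp 1 := Real.one_le_exp zero_le_one
  set K : ℝ := 336 ^ 2 * (2 * (2 * Real.exp 1 * R) ^ 2) with hK
  have hK4 : 4 ≤ K := by
    have : 1 ≤ Real.exp 1 * R := one_le_mul_of_one_le_of_one_le he hR1
    rw [hK]
    nlinarith
  -- Here 168 = 84 · 2 from N ≤ 84/ε and ℓ ≤ 2L, and 1416240 = 30 · 168 + 100 · 84² · 2.
  refine ⟨20, 168, K, 1416240, by norm_num, by norm_num, by linarith, by norm_num, ?_⟩
  intro 𝕜 _ n hn A hA hnorm ε δ hε hδ L ℓ N hL hℓ hN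
  have hspec := hA.abs_eigenvalues_le_one hnorm
  obtain ⟨hε0, hε1⟩ := id hε
  obtain ⟨hδ0, hδ1⟩ := id hδ
  have hn' : (0 : ℝ) < n := by exact_mod_cast hn
  have hL1 : 1 ≤ L := hL ▸ le_max_left _ _
  have hL2 : K * (1 / ε ^ 4) * Real.log (1 / (ε * δ)) ^ 2 ≤ n * L := by
    have : K / n * (1 / ε ^ 4) * Real.log (1 / (ε * δ)) ^ 2 ≤ L := hL ▸ le_max_right _ _
    calc K * (1 / ε ^ 4) * Real.log (1 / (ε * δ)) ^ 2
        = n * (K / n * (1 / ε ^ 4) * Real.log (1 / (ε * δ)) ^ 2) := by field_simp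
      _ ≤ _ := by gcongr
  have hℓL : L ≤ ℓ := hℓ ▸ Nat.le_ceil L
  have hℓL2 : (ℓ : ℝ) ≤ 2 * L := by
    have := Nat.ceil_lt_add_one (by linarith : 0 ≤ L)
    rw [← hℓ] at this
    linarith
  have hℓ0 : 0 < ℓ := by
    have : (0 : ℝ) < ℓ := by linarith
    exact_mod_cast this
  obtain ⟨hN1, hN2⟩ := degree_mem_Icc hε
  rw [← hN] at hN1 hN2
  obtain ⟨h, rfl⟩ : ∃ h, N = 2 * h := ⟨2 * ⌈20 / ε⌉₊, by rw [hN]; ring⟩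
  have hdiv : 1 ≤ 1 / ε := by rw [le_div_iff₀ hε0]; linarith
  have hh40 : 40 ≤ h := by
    have : (80 : ℝ) ≤ (2 * h : ℕ) := by
      have : 80 / ε = 80 * (1 / ε) := by ring
      linarith
    have : 80 ≤ 2 * h := by exact_mod_cast this
    omega
  have hNpos : (0 : ℝ) < (2 * h : ℕ) := by
    have : 0 < 2 * h := by omega
    exact_mod_cast this
  have hNℓ : (((2 * h : ℕ) : ℝ) * ℓ) ≤ 168 * L / ε := by
    calc ((2 * h : ℕ) : ℝ) * ℓ ≤ 84 / ε * (2 * L) := by gcongr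
      _ = 168 * L / ε := by ring
  refine ⟨fun ω => ⟨?_, hNℓ, ?_, isProbabilityDensity_run_kpm hA hspec hn hℓ0 (by omega) ω⟩, ?_⟩
  · rw [Prog.run_kpm_matvecs, Prog.run_hutchinson_matvecs]
  · refine (run_kpm_hutchinson_steps_le hn (by omega) hℓ0 ω).trans ?_
    have h1 := one_div_le_two_mul hn hε hδ hK4 hL1 hL2
    have h2 : ((2 * h : ℕ) : ℝ) ^ 2 ≤ 84 ^ 2 * (2 * (n * L / ε)) := by
      calc ((2 * h : ℕ) : ℝ) ^ 2 ≤ (84 / ε) ^ 2 := by gcongr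
        _ = 84 ^ 2 * (1 / ε) * (1 / ε) := by ring
        _ ≤ 84 ^ 2 * (1 / ε) * (2 * (n * L)) := by gcongr
        _ = _ := by ring
    have h3 : (n : ℝ) * (2 * h : ℕ) * ℓ ≤ 168 * (n * L / ε) := by
      calc (n : ℝ) * (2 * h : ℕ) * ℓ = n * ((2 * h : ℕ) * ℓ) := by ring
        _ ≤ n * (168 * L / ε) := by gcongr
        _ = _ := by ring
    linarith
  rw [uniformOfFintype_toOuterMeasure_eq]
  refine ENNReal.ofReal_le_ofReal ?_
  rw [signProb_compl]
  refine sub_le_sub_left ?_ 1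
  by_cases hcase : ε ≤ 1 - κ ∨ δ ≤ 1 - κ
  · have hΛ := log_inv_mul_ge hε hδ hcase
    set Λ := Real.log (1 / (ε * δ)) with hΛdef
    have hΛ0 : 0 ≤ Λ := le_trans (by positivity) hΛ
    have hrR : Real.log 84 + Λ ≤ R * Λ := by
      rw [hR, add_mul, one_mul]
      have : Real.log 84 / κ * κ ≤ Real.log 84 / κ * Λ := by gcongr
      rw [div_mul_cancel₀ _ (by norm_num)] at this
      linarith
    -- With η = ε²/336 the moment errors cost at most 2Nη ≤ ε/2. With this r the union bound over N
    -- ≤ 84/ε moments gives N εδ/84 ≤ δ.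
    refine (signProb_wasserstein1_gt_le hA hspec hn hℓ0 (by omega) (r := Real.log 84 + Λ)
      (η := ε ^ 2 / 336) (by linarith) (by positivity) ?_ ?_).trans ?_
    · calc 2 * (2 * Real.exp 1 * (Real.log 84 + Λ)) ^ 2
          ≤ 2 * (2 * Real.exp 1 * (R * Λ)) ^ 2 := by gcongr
        _ = (ε ^ 2 / 336) ^ 2 * (K * (1 / ε ^ 4) * Λ ^ 2) := by
          rw [hK]
          field_simp
        _ ≤ (ε ^ 2 / 336) ^ 2 * (n * L) := by gcongr
        _ ≤ (ε ^ 2 / 336) ^ 2 * (ℓ * n) := by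
          rw [mul_comm (ℓ : ℝ)]
          gcongr
    · have h1 : 14 / ((2 * h : ℕ) : ℝ) ≤ 14 / (80 / ε) := by gcongr
      have h2 : ((2 * h : ℕ) : ℝ) * (ε ^ 2 / 336) ≤ 84 / ε * (ε ^ 2 / 336) := by gcongr
      have e1 : 14 / (80 / ε) = 7 / 40 * ε := by field_simp; norm_num
      have e2 : 84 / ε * (ε ^ 2 / 336) = ε / 4 := by field_simp; norm_num
      linarith
    · have e1 : Real.exp (-(Real.log 84 + Λ)) = ε * δ / 84 := by
        rw [neg_add, Real.exp_add, Real.exp_neg, Real.exp_log (by norm_num), hΛdef, one_div,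
          Real.log_inv, neg_neg, Real.exp_log (by positivity)]
        ring
      rw [e1]
      calc ((2 * h : ℕ) : ℝ) * (ε * δ / 84) ≤ 84 / ε * (ε * δ / 84) := by gcongr
        _ = δ := by field_simp
  · push Not at hcase
    obtain ⟨h1, h2⟩ := hcase
    have hh84 : h ≤ 84 := by
      have h3 : ((2 * h : ℕ) : ℝ) < 169 := by
        refine hN2.trans_lt ?_
        rw [div_lt_iff₀ hε0]
        rw [hκ] at h1
        linarith
      have : 2 * h < 169 := by exact_mod_cast h3
      omega
    -- A failure probability above δ would give ε times it more than (1 - κ)² > 1 - 1/3840.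
    have h3 := mul_signProb_wasserstein1_gt_le hA hspec hn hℓ0 hh40 hh84 ε
    by_contra hcon
    rw [not_le] at hcon
    rw [hκ] at h1 h2
    nlinarith
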